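/- Let $p$ be a prime, $n\ge 0$, and let $g(x)\in\mathbb Z_p[x_1^{\pm1},\dots,x_n^{\pm1}]$ be a Laurent polynomial whose Newton polytope $\Delta\subset\mathbb R^n$ (the convex hull of the exponents of $g$) has $0$ as its only interior lattice point. Put $f=1-t\,g(x)$, $q(t)=\sum_{k\ge0}b_kt^k\in\mathbb Z_p[[t]]$ with $b_k$ the constant term of $g(x)^k$, and let $\beta_p(t)\in\mathbb Z_p[t]$ be the constant term (in $x$) of $f(x)^{p-1}$; one has $\beta_p(0)=1$. Let $R\subset\mathbb Z_p[[t]]$ be the $p$-adic completion of $\mathbb Z_p[t,\beta_p(t)^{-1}]$, with the Frobenius lift $\sigma:h(t)\mapsto h(t^p)$; for a Laurent polynomial $h$ over $R$ let $h^\sigma$ be obtained by applying $\sigma$ to the coefficients, so $f^\sigma=1-t^pg(x)$. For a Laurent polynomial $h$ over $R$ let $\Omega_h(\Delta^\circ)$ be the $R$-module generated by the rational functions $(k-1)!\,a(x)/h(x)^k$ with $k\ge1$ and $\operatorname{supp}(a)\subset k\Delta^\circ$, and $\widehat\Omega_h(\Delta^\circ)$ its $p$-adic completion, viewed inside the $p$-adic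 completion of $R[x_1^{\pm1},\dots,x_n^{\pm1},1/h]$. The Cartier operator $\mathscr C_p$ is the $R$-linear $p$-adically continuous map from the completion of $R[x^{\pm1},1/h]$ to that of $R[x^{\pm1},1/h^\sigma]$ which extends $\sum_u a_ux^u\mapsto\sum_u a_{pu}x^u$ on Laurent polynomials and satisfies $\mathscr C_p(h^\sigma(x^p)\,\omega)=h^\sigma(x)\,\mathscr C_p(\omega)$. Let $$U_h=\{\omega\in\widehat\Omega_h(\Delta^\circ)\;:\;\mathscr C_p^s(\omega)\in p^s\,\widehat\Omega_{h^{\sigma^s}}(\Delta^\circ)\text{ for all }s\ge1\},\qquad Q_h(\Delta^\circ)=\widehat\Omega_h(\Delta^\circ)/U_h .$$ Then there is $\Lambda\in R$ with $$\frac{q(t)}{q(t^p)}=\Lambda ;$$ in particular this ratio lies in the $p$-adic completion of $\mathbb Z_p[t,\beta_p(t)^{-1}]$. Moreover, if $p\ne2$, then $\mathscr C_p$ maps $\widehat\Omega_f(\Delta^\circ)$ to $\widehat\Omega_{f^\sigma}(\Delta^\circ)$ and $U_f$ to $U_{f^\sigma}$, the $R$-modules $Q_f(\Delta^\circ)$ and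 $Q_{f^\sigma}(\Delta^\circ)$ are free of rank one with bases the classes of $1/f$ and $1/f^\sigma$, and $\Lambda$ is the single entry of the matrix of $\mathscr C_p:Q_f(\Delta^\circ)\to Q_{f^\sigma}(\Delta^\circ)$ with respect to these bases. -/

import Mathlib

open scoped Pointwise

noncomputable section

namespace DworkCrystal

/-- Laurent polynomials in `x_1, …, x_n` over `R`, indexed by their exponent vectors. -/
abbrev Laurent (R : Type*) [CommRing R] (n : ℕ) : Type _ := AddMonoidAlgebra R (Fin n → ℤ)

/-- An integral vector seen in `ℝ^n`. -/
def toReal {n : ℕ} (u : Fin n → ℤ) : Fin n → ℝ := fun i => (u i : ℝ)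

/-- The Newton polytope: the convex hull in `ℝ^n` of the exponents occurring in `f`. -/
def newtonPolytope {R : Type*} [CommRing R] {n : ℕ} (f : Laurent R n) : Set (Fin n → ℝ) :=
  convexHull ℝ (toReal '' (f.coeff.support : Set (Fin n → ℤ)))

/-- A Frobenius lift: a ring endomorphism `σ` with `σ r ≡ r ^ p` modulo `p`. -/
structure FrobeniusLift (p : ℕ) (R : Type*) [CommRing R] where
  toRingHom : R →+* R
  dvd_sub : ∀ r : R, (p : R) ∣ toRingHom r - r ^ p

section General

variable {p : ℕ} {R : Type*} [CommRing R] {n : ℕ}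

/-- `f ↦ f^σ`: apply `σ` to the coefficients. -/
def twist (σ : FrobeniusLift p R) : Laurent R n →+* Laurent R n :=
  AddMonoidAlgebra.mapRingHom (Fin n → ℤ) σ.toRingHom

/-- The substitution `a(x) ↦ a(x^p)`. -/
def inflate (p : ℕ) (R : Type*) [CommRing R] (n : ℕ) : Laurent R n →+* Laurent R n :=
  AddMonoidAlgebra.mapDomainRingHom R (nsmulAddMonoidHom (α := Fin n → ℤ) p)

theorem nsmul_inj (hp : p ≠ 0) : Function.Injective (fun u : Fin n → ℤ => p • u) := by
  intro u v h
  funext i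
  have := congrFun h i
  simpa [hp] using this

/-- The Cartier operation on Laurent polynomials: `∑ a_k x^k ↦ ∑ a_{pk} x^k`. -/
def decimate (p : ℕ) [Fact p.Prime] (R : Type*) [CommRing R] (n : ℕ) :
    Laurent R n →ₗ[R] Laurent R n where
  toFun a := ⟨a.coeff.comapDomain (fun u => p • u) (nsmul_inj (Fact.out : p.Prime).ne_zero).injOn⟩
  map_add' a b := by ext; simp
  map_smul' c a := by ext; simp

theorem decimate_coeff [Fact p.Prime] (a : Laurent R n) (u : Fin n → ℤ) :
    (decimate p R n a).coeff u = a.coeff (p • u) := rfl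

theorem decimate_inflate_mul [Fact p.Prime] (b a : Laurent R n) :
    decimate p R n (inflate p R n b * a) = b * decimate p R n a := by
  induction b using AddMonoidAlgebra.induction_linear with
  | zero => simp
  | add x y hx hy => simp [add_mul, hx, hy]
  | single u r =>
    have h : inflate p R n (AddMonoidAlgebra.single u r) = AddMonoidAlgebra.single (p • u) r := by
      simp [inflate]
    rw [h]
    ext v
    rw [decimate_coeff, AddMonoidAlgebra.coeff_single_mul_apply, AddMonoidAlgebra.coeff_single_mul_apply,
      decimate_coeff]
    congr 2
    simp [smul_add]

theorem dvd_inflate_twist_sub [Fact p.Prime] (σ : FrobeniusLift p R) (b : Laurent R n) :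
    (p : Laurent R n) ∣ inflate p R n (twist σ b) - b ^ p := by
  induction b using AddMonoidAlgebra.induction_linear with
  | zero => simp [(Fact.out : p.Prime).ne_zero]
  | add x y hx hy =>
    obtain ⟨r, hr⟩ := exists_add_pow_prime_eq (Fact.out : p.Prime) x y
    have : inflate p R n (twist σ (x + y)) - (x + y) ^ p =
        (inflate p R n (twist σ x) - x ^ p) + (inflate p R n (twist σ y) - y ^ p)
          - p * (x * y * r) := by
      rw [hr, map_add, map_add]; ring
    rw [this]
    exact dvd_sub (dvd_add hx hy) (dvd_mul_right _ _)
  | single u r =>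
    obtain ⟨c, hc⟩ := σ.dvd_sub r
    refine ⟨AddMonoidAlgebra.single (p • u) c, ?_⟩
    have h : inflate p R n (twist σ (AddMonoidAlgebra.single u r)) =
        AddMonoidAlgebra.single (p • u) (σ.toRingHom r) := by
      simp [inflate, twist]
    rw [h, AddMonoidAlgebra.single_pow, ← AddMonoidAlgebra.single_sub, hc]
    ext v
    rw [← nsmul_eq_mul, ← nsmul_eq_mul]
    simp

theorem dvd_decimate [Fact p.Prime] (s : ℕ) {a : Laurent R n} (h : (p : Laurent R n) ^ s ∣ a) :
    (p : Laurent R n) ^ s ∣ decimate p R n a := by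
  obtain ⟨b, rfl⟩ := h
  refine ⟨decimate p R n b, ?_⟩
  have : ((p : Laurent R n) ^ s * b) = (p ^ s : ℕ) • b := by simp
  rw [this, map_nsmul]
  simp

theorem dvd_decimate_mul_pow_sub [Fact p.Prime] (σ : FrobeniusLift p R) (s : ℕ)
    (a c : Laurent R n) :
    (p : Laurent R n) ^ s ∣
      decimate p R n (a * c ^ p ^ (s + 1)) - twist σ c ^ p ^ s * decimate p R n a := by
  rw [← decimate_inflate_mul, ← map_sub]
  apply dvd_decimate
  have h := dvd_sub_pow_of_dvd_sub (dvd_inflate_twist_sub σ c) s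
  rw [← pow_mul, ← pow_succ'] at h
  have h2 := (dvd_mul_of_dvd_left h a)
  rw [map_pow, show a * c ^ p ^ (s + 1) - inflate p R n (twist σ c) ^ p ^ s * a
    = -((inflate p R n (twist σ c) ^ p ^ s - c ^ p ^ (s + 1)) * a) by ring]
  exact (dvd_neg.2 ((pow_dvd_pow _ (Nat.le_succ s)).trans h2))

/-- The ring of fractions `R[x^{±1}, 1/f]`, whose elements are the rational functions `g/f^k`. -/
abbrev Frac (f : Laurent R n) : Type _ := Localization.Away f

/-- The rational function `g/f^k`. -/
def frac (f g : Laurent R n) (k : ℕ) : Frac f :=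
  Localization.mk g (⟨f ^ k, k, rfl⟩ : Submonoid.powers f)

/-- The `p`-adic completion of an `R`-module. -/
abbrev Compl (p : ℕ) (R : Type*) [CommRing R] (M : Type*) [AddCommGroup M] [Module R M] : Type _ :=
  AdicCompletion (Ideal.span {(p : R)}) M

theorem twist_mem (σ : FrobeniusLift p R) (f : Laurent R n) (b : Submonoid.powers f) (N : ℕ) :
    twist σ (b : Laurent R n) ^ N ∈ Submonoid.powers (twist σ f) := by
  obtain ⟨_, k, rfl⟩ := b
  exact ⟨k * N, by simp [pow_mul]⟩

/-- The quotient `M / p^s M`. -/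
abbrev ModPow (p : ℕ) (R : Type*) [CommRing R] (M : Type*) [AddCommGroup M] [Module R M] (s : ℕ) :
    Type _ :=
  M ⧸ (Ideal.span {(p : R)} ^ s • (⊤ : Submodule R M))

theorem mkQ_eq_of_dvd {h : Laurent R n} (s : ℕ) (a a' : Laurent R n) (d d' e : Submonoid.powers h)
    (H : (p : Laurent R n) ^ s ∣ e * (a * d' - a' * d)) :
    (Submodule.Quotient.mk (Localization.mk a d) : ModPow p R (Frac h) s) =
      Submodule.Quotient.mk (Localization.mk a' d') := by
  rw [Submodule.Quotient.eq]
  obtain ⟨w, hw⟩ := H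
  have : Localization.mk a d - Localization.mk a' d' =
      ((p : R) ^ s) • Localization.mk w (e * (d * d')) := by
    have h1 : (p : R) ^ s • w = e * (a * d' - a' * d) := by
      rw [hw, Algebra.smul_def, map_pow, map_natCast]
    rw [Localization.sub_mk, Localization.smul_mk, h1, Localization.mk_eq_mk_iff,
      Localization.r_iff_exists]
    refine ⟨1, ?_⟩
    simp only [Submonoid.coe_mul, Submonoid.coe_one]
    ring
  rw [this]
  exact Submodule.smul_mem_smul (Ideal.pow_mem_pow (Ideal.mem_span_singleton_self _) _) trivial

/-- The Cartier operator on fractions modulo `p^s`. Modulo `p^s` one has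
`b(x)^(p^(s+1)) ≡ b^σ(x^p)^(p^s)`, so that `a/b = a b^(p^(s+1)-1) / b^(p^(s+1))` is mapped to the
result of the Cartier operation on `a b^(p^(s+1)-1)`, divided by `(b^σ)^(p^s)`. -/
def cartierLevel [Fact p.Prime] (σ : FrobeniusLift p R) (f : Laurent R n) (s : ℕ) :
    Frac f →ₗ[R] ModPow p R (Frac (twist σ f)) s where
  toFun z := Localization.liftOn z
    (fun a b => Submodule.Quotient.mk (Localization.mk
      (decimate p R n (a * (b : Laurent R n) ^ (p ^ (s + 1) - 1)))
      (⟨twist σ (b : Laurent R n) ^ p ^ s, twist_mem σ f b _⟩ : Submonoid.powers (twist σ f))))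
    (by
      intro a a' b b' hr
      obtain ⟨c, hc⟩ := Localization.r_iff_exists.1 hr
      apply mkQ_eq_of_dvd s _ _ _ _ ⟨twist σ (c : Laurent R n) ^ p ^ s, twist_mem σ f c _⟩
      have h1 := dvd_decimate_mul_pow_sub σ s (a * (b : Laurent R n) ^ (p ^ (s + 1) - 1)) (b' * c)
      have h2 := dvd_decimate_mul_pow_sub σ s (a' * (b' : Laurent R n) ^ (p ^ (s + 1) - 1)) (b * c)
      have hN : p ^ (s + 1) ≠ 0 := pow_ne_zero _ (Fact.out : p.Prime).ne_zero
      have h3 : a * (b : Laurent R n) ^ (p ^ (s + 1) - 1) * (b' * c) ^ p ^ (s + 1) =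
          a' * (b' : Laurent R n) ^ (p ^ (s + 1) - 1) * (b * c) ^ p ^ (s + 1) := by
        obtain ⟨N, hN⟩ := Nat.exists_eq_succ_of_ne_zero hN
        rw [hN]
        simp only [Nat.succ_eq_add_one, Nat.add_sub_cancel, mul_pow, pow_succ]
        simp only at hc
        linear_combination ((b : Laurent R n) ^ N * (b' : Laurent R n) ^ N * (c : Laurent R n) ^ N)
          * hc
      rw [h3] at h1
      have h4 := dvd_sub h2 h1
      simp only [map_mul, mul_pow] at h4 ⊢
      convert h4 using 1
      ring)
  map_add' := by
    intro x y
    induction x using Localization.induction_on with | _ x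
    induction y using Localization.induction_on with | _ y
    obtain ⟨a, b⟩ := x
    obtain ⟨a', b'⟩ := y
    simp only [Localization.add_mk, Localization.liftOn_mk]
    rw [← Submodule.Quotient.mk_add, Localization.add_mk]
    apply mkQ_eq_of_dvd s _ _ _ _ 1
    have h1 := dvd_decimate_mul_pow_sub σ s (a * (b : Laurent R n) ^ (p ^ (s + 1) - 1)) b'
    have h2 := dvd_decimate_mul_pow_sub σ s (a' * (b' : Laurent R n) ^ (p ^ (s + 1) - 1)) b
    have hN : p ^ (s + 1) ≠ 0 := pow_ne_zero _ (Fact.out : p.Prime).ne_zero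
    have h3 : (b * a' + b' * a) * (b * b' : Laurent R n) ^ (p ^ (s + 1) - 1) =
        a * (b : Laurent R n) ^ (p ^ (s + 1) - 1) * b' ^ p ^ (s + 1) +
        a' * (b' : Laurent R n) ^ (p ^ (s + 1) - 1) * b ^ p ^ (s + 1) := by
      obtain ⟨N, hN⟩ := Nat.exists_eq_succ_of_ne_zero hN
      rw [hN]
      simp only [Nat.succ_eq_add_one, Nat.add_sub_cancel, mul_pow, pow_succ]
      ring
    simp only [Submonoid.coe_mul, Submonoid.coe_one, one_mul]
    rw [h3]
    simp only [map_add, map_mul, mul_pow]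
    have h4 := dvd_mul_of_dvd_right (dvd_add h1 h2)
      (twist σ (b : Laurent R n) ^ p ^ s * twist σ (b' : Laurent R n) ^ p ^ s)
    convert h4 using 1
    ring
  map_smul' := by
    intro r x
    induction x using Localization.induction_on with | _ x
    obtain ⟨a, b⟩ := x
    simp only [Localization.smul_mk, Localization.liftOn_mk, RingHom.id_apply]
    rw [← Submodule.Quotient.mk_smul, Localization.smul_mk, smul_mul_assoc, map_smul]

theorem cartierLevel_compat [Fact p.Prime] (σ : FrobeniusLift p R) (f : Laurent R n) {s s' : ℕ}
    (h : s ≤ s') :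
    AdicCompletion.transitionMap (Ideal.span {(p : R)}) (Frac (twist σ f)) h ∘ₗ
      cartierLevel σ f s' = cartierLevel σ f s := by
  ext x
  induction x using Localization.induction_on with | _ x
  obtain ⟨a, b⟩ := x
  change (Submodule.Quotient.mk _ : ModPow p R (Frac (twist σ f)) s) = Submodule.Quotient.mk _
  obtain ⟨d, rfl⟩ := Nat.exists_eq_add_of_le h
  apply mkQ_eq_of_dvd s _ _ _ _ 1
  have hp : 0 < p := (Fact.out : p.Prime).pos
  have h1 := dvd_decimate_mul_pow_sub σ s (a * (b : Laurent R n) ^ (p ^ (s + 1) - 1))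
    ((b : Laurent R n) ^ (p ^ d - 1))
  have e1 : (p ^ (s + 1) - 1) + (p ^ d - 1) * p ^ (s + 1) = p ^ (s + d + 1) - 1 := by
    have := Nat.one_le_pow d p hp
    have := Nat.one_le_pow (s + 1) p hp
    obtain ⟨A, hA⟩ := Nat.exists_eq_add_of_le (Nat.one_le_pow d p hp)
    obtain ⟨B, hB⟩ := Nat.exists_eq_add_of_le (Nat.one_le_pow (s + 1) p hp)
    rw [show s + d + 1 = d + (s + 1) by ring, pow_add p d (s + 1), hA, hB]
    simp only [Nat.add_sub_cancel_left]
    have : (1 + A) * (1 + B) = 1 + (B + A * (1 + B)) := by ring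
    rw [this, Nat.add_sub_cancel_left]
  have e2 : p ^ s + (p ^ d - 1) * p ^ s = p ^ (s + d) := by
    obtain ⟨A, hA⟩ := Nat.exists_eq_add_of_le (Nat.one_le_pow d p hp)
    rw [pow_add, hA, Nat.add_sub_cancel_left]
    ring
  rw [← pow_mul, mul_assoc, ← pow_add, e1, map_pow, ← pow_mul] at h1
  have h2 := dvd_mul_of_dvd_right h1 (twist σ (b : Laurent R n) ^ p ^ s)
  simp only [Submonoid.coe_one, one_mul]
  convert h2 using 1
  rw [← e2, pow_add]
  ring

/-- The Cartier operator modulo `p^s`. -/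
def cartierMod [Fact p.Prime] (σ : FrobeniusLift p R) (f : Laurent R n) (s : ℕ) :
    ModPow p R (Frac f) s →ₗ[R] ModPow p R (Frac (twist σ f)) s :=
  Submodule.liftQ _ (cartierLevel σ f s) (by
    rw [Submodule.smul_le]
    intro r hr x _
    rw [LinearMap.mem_ker, map_smul]
    induction cartierLevel σ f s x using Submodule.Quotient.induction_on with | _ y
    rw [← Submodule.Quotient.mk_smul, Submodule.Quotient.mk_eq_zero]
    exact Submodule.smul_mem_smul hr trivial)

theorem cartierMod_compat [Fact p.Prime] (σ : FrobeniusLift p R) (f : Laurent R n) {s s' : ℕ}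
    (h : s ≤ s') :
    AdicCompletion.transitionMap (Ideal.span {(p : R)}) (Frac (twist σ f)) h ∘ₗ
      cartierMod σ f s' =
    cartierMod σ f s ∘ₗ AdicCompletion.transitionMap (Ideal.span {(p : R)}) (Frac f) h := by
  refine LinearMap.ext fun z => ?_
  induction z using Submodule.Quotient.induction_on with | _ y
  exact LinearMap.congr_fun (cartierLevel_compat σ f h) y

/-- The Cartier operator `𝒞_p` between the `p`-adic completions of `R[x^{±1}, 1/f]` and
`R[x^{±1}, 1/f^σ]`: the `R`-linear, `p`-adically continuous extension of
`∑ a_k x^k ↦ ∑ a_{pk} x^k` for which `𝒞_p (b^σ(x^p) ω) = b^σ 𝒞_p ω`. -/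
def cartier [Fact p.Prime] (σ : FrobeniusLift p R) (f : Laurent R n) :
    Compl p R (Frac f) →ₗ[R] Compl p R (Frac (twist σ f)) :=
  AdicCompletion.lift _
    (fun s => cartierMod σ f s ∘ₗ AdicCompletion.eval (Ideal.span {(p : R)}) (Frac f) s)
    (by
      intro s s' h
      rw [← LinearMap.comp_assoc, cartierMod_compat, LinearMap.comp_assoc,
        AdicCompletion.transitionMap_comp_eval])

/-- The iterate `𝒞_p^s`, from the completion for `f` to the one for `f^{σ^s}`. -/
def cartierIter [Fact p.Prime] (σ : FrobeniusLift p R) :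
    (s : ℕ) → (f : Laurent R n) →
      (Compl p R (Frac f) →ₗ[R] Compl p R (Frac ((twist σ)^[s] f)))
  | 0, _ => LinearMap.id
  | s + 1, f => cartierIter σ s (twist σ f) ∘ₗ cartier σ f

/-- `Ω_f(μ)`: the `R`-module generated by the `(k-1)! g/f^k`, `k ≥ 1`, `supp g ⊆ kμ`. -/
def Omega (f : Laurent R n) (μ : Set (Fin n → ℝ)) : Submodule R (Frac f) :=
  Submodule.span R {ω | ∃ (k : ℕ) (g : Laurent R n), 1 ≤ k ∧
    (∀ u ∈ g.coeff.support, toReal u ∈ (k : ℝ) • μ) ∧ ω = (k - 1).factorial • frac f g k}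

/-- The `p`-adic completion of `Ω_f(μ)`, as a submodule of the `p`-adic completion of
`R[x^{±1}, 1/f]`: the image of the map of completions induced by the inclusion of `Ω_f(μ)`. (When `f` is not a zero
divisor modulo `p` and `R` has no integer torsion, that map is injective; in any case its kernel
would not change the quotient `Q_f(μ)`.) -/
def OmegaHat (p : ℕ) (f : Laurent R n) (μ : Set (Fin n → ℝ)) : Submodule R (Compl p R (Frac f)) :=
  LinearMap.range
    ((AdicCompletion.map (Ideal.span {(p : R)}) (Omega f μ).subtype).restrictScalars R)

/-- `U_f(μ)`: the `ω` in the completed `Ω_f(μ)` such that, for all `s ≥ 1`, `𝒞_p^s ω` lies in `p^s`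
times the completion of `Ω_{f^{σ^s}}(μ)`. -/
def U [Fact p.Prime] (σ : FrobeniusLift p R) (f : Laurent R n) (μ : Set (Fin n → ℝ)) :
    Submodule R (Compl p R (Frac f)) :=
  OmegaHat p f μ ⊓ ⨅ (s : ℕ) (_ : 1 ≤ s),
    (((p : R) ^ s) • OmegaHat p ((twist σ)^[s] f) μ).comap (cartierIter σ s f)

/-- `Q_f(μ)`: the quotient of the completed `Ω_f(μ)` by `U_f(μ)`. -/
abbrev Q [Fact p.Prime] (σ : FrobeniusLift p R) (f : Laurent R n) (μ : Set (Fin n → ℝ)) : Type _ :=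
  OmegaHat p f μ ⧸ (U σ f μ).submoduleOf (OmegaHat p f μ)

/-- The map `Q_f(μ) → Q_{f^σ}(μ)` induced by the Cartier operator, once the latter is known to
respect the completed modules and the submodules `U`. -/
def cartierQ [Fact p.Prime] (σ : FrobeniusLift p R) (f : Laurent R n) (μ : Set (Fin n → ℝ))
    (hΩ : ∀ ω ∈ OmegaHat p f μ, cartier σ f ω ∈ OmegaHat p (twist σ f) μ)
    (hU : ∀ ω ∈ U σ f μ, cartier σ f ω ∈ U σ (twist σ f) μ) :
    Q σ f μ →ₗ[R] Q σ (twist σ f) μ :=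
  Submodule.mapQ _ _ ((cartier σ f).restrict hΩ) (fun ω hω => hU ω hω)

/-- `ω_u = x^u / f`, in the completion of `R[x^{±1}, 1/f]`. -/
def omega (p : ℕ) (f : Laurent R n) (u : Fin n → ℤ) : Compl p R (Frac f) :=
  AdicCompletion.of _ _ (frac f (AddMonoidAlgebra.single u 1) 1)

/-- The entry `(u, v)` of the Hasse–Witt matrix: the coefficient of `x^{pv-u}` in `f^{p-1}`. -/
def hasseWitt (p : ℕ) (f : Laurent R n) (u v : Fin n → ℤ) : R :=
  (f ^ (p - 1)).coeff (p • v - u)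

end General
section Completion

open Polynomial

variable {p : ℕ} [Fact p.Prime]

/-- The ring `ℤ_p[t, β(t)⁻¹]`, for a polynomial `β` with constant coefficient `1`, as a subalgebra
of `ℤ_p⟦t⟧`. -/
def fracAlg (β : ℤ_[p][X]) : Subalgebra ℤ_[p] (PowerSeries ℤ_[p]) :=
  Algebra.adjoin ℤ_[p] {PowerSeries.X, PowerSeries.invOfUnit (β : PowerSeries ℤ_[p]) 1}

/-- The `p`-adic completion of `ℤ_p[t, β(t)⁻¹]`, realised as its `p`-adic closure in `ℤ_p⟦t⟧`:
the power series that are congruent, modulo every power of `p`, to an element of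
`ℤ_p[t, β(t)⁻¹]`. (As `ℤ_p[t, β(t)⁻¹] ∩ p^s ℤ_p⟦t⟧ = p^s ℤ_p[t, β(t)⁻¹]` and `ℤ_p⟦t⟧` is
`p`-adically complete, the closure is the completion.) -/
def completedAlg (β : ℤ_[p][X]) : Subalgebra ℤ_[p] (PowerSeries ℤ_[p]) where
  carrier := {h | ∀ s : ℕ, ∃ y ∈ fracAlg β, (p : PowerSeries ℤ_[p]) ^ s ∣ h - y}
  mul_mem' := by
    intro a b ha hb s
    obtain ⟨y, hy, hay⟩ := ha s
    obtain ⟨z, hz, hbz⟩ := hb s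
    refine ⟨y * z, mul_mem hy hz, ?_⟩
    rw [show a * b - y * z = (a - y) * b + y * (b - z) by ring]
    exact dvd_add (hay.mul_right _) (hbz.mul_left _)
  add_mem' := by
    intro a b ha hb s
    obtain ⟨y, hy, hay⟩ := ha s
    obtain ⟨z, hz, hbz⟩ := hb s
    refine ⟨y + z, add_mem hy hz, ?_⟩
    rw [show a + b - (y + z) = (a - y) + (b - z) by ring]
    exact dvd_add hay hbz
  algebraMap_mem' r s := ⟨algebraMap _ _ r, Subalgebra.algebraMap_mem _ r, by simp⟩

theorem fracAlg_le (β : ℤ_[p][X]) : fracAlg β ≤ completedAlg β :=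
  fun h hh _ => ⟨h, hh, by simp⟩

theorem dvd_iff_map (h : PowerSeries ℤ_[p]) :
    (p : PowerSeries ℤ_[p]) ∣ h ↔ PowerSeries.map (PadicInt.toZMod (p := p)) h = 0 := by
  constructor
  · rintro ⟨e, rfl⟩
    rw [map_mul, map_natCast]
    ext k
    rw [← nsmul_eq_mul, map_nsmul]
    simp
  · intro hh
    have : ∀ k, ∃ c : ℤ_[p], PowerSeries.coeff k h = p * c := by
      intro k
      have h1 : PadicInt.toZMod (PowerSeries.coeff k h) = 0 := by
        rw [← PowerSeries.coeff_map, hh, map_zero]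
      have h2 : PowerSeries.coeff k h ∈ RingHom.ker (PadicInt.toZMod (p := p)) := h1
      rw [PadicInt.ker_toZMod, PadicInt.maximalIdeal_eq_span_p, Ideal.mem_span_singleton] at h2
      exact h2
    choose c hc using this
    refine ⟨PowerSeries.mk c, ?_⟩
    ext k
    rw [hc, ← nsmul_eq_mul p (PowerSeries.mk c), map_nsmul, PowerSeries.coeff_mk,
      nsmul_eq_mul]

/-- `h(t) ↦ h(t^p)` on `ℤ_p⟦t⟧`. -/
def substPow (p : ℕ) [Fact p.Prime] : PowerSeries ℤ_[p] →ₐ[ℤ_[p]] PowerSeries ℤ_[p] :=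
  PowerSeries.expand p (Fact.out : p.Prime).ne_zero

theorem dvd_substPow_sub (h : PowerSeries ℤ_[p]) :
    (p : PowerSeries ℤ_[p]) ∣ substPow p h - h ^ p := by
  rw [dvd_iff_map, map_sub, map_pow, substPow, PowerSeries.map_expand]
  have := MvPowerSeries.map_frobenius_expand p (Fact.out : p.Prime).ne_zero
    (f := PowerSeries.map (PadicInt.toZMod (p := p)) h)
  rw [ZMod.frobenius_zmod] at this
  rw [← this, sub_eq_zero, MvPowerSeries.map_id]
  rfl

theorem beta_mul_inv {β : ℤ_[p][X]} (hβ : β.coeff 0 = 1) :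
    (β : PowerSeries ℤ_[p]) * PowerSeries.invOfUnit (β : PowerSeries ℤ_[p]) 1 = 1 :=
  PowerSeries.mul_invOfUnit _ _ (by
    rw [← PowerSeries.coeff_zero_eq_constantCoeff_apply, Polynomial.coeff_coe, hβ]; rfl)

theorem X_mem (β : ℤ_[p][X]) : (PowerSeries.X : PowerSeries ℤ_[p]) ∈ fracAlg β :=
  Algebra.subset_adjoin (by simp)

theorem inv_mem (β : ℤ_[p][X]) :
    PowerSeries.invOfUnit (β : PowerSeries ℤ_[p]) 1 ∈ fracAlg β :=
  Algebra.subset_adjoin (by simp)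

theorem coe_mem (β a : ℤ_[p][X]) : (a : PowerSeries ℤ_[p]) ∈ fracAlg β := by
  induction a using Polynomial.induction_on' with
  | add a b ha hb => rw [Polynomial.coe_add]; exact add_mem ha hb
  | monomial k c =>
    rw [← Polynomial.C_mul_X_pow_eq_monomial, Polynomial.coe_mul, Polynomial.coe_pow,
      Polynomial.coe_X, Polynomial.coe_C]
    exact mul_mem (Subalgebra.algebraMap_mem (fracAlg β) c) (pow_mem (X_mem β) k)

theorem exists_pow_mul {β : ℤ_[p][X]} (hβ : β.coeff 0 = 1) {y : PowerSeries ℤ_[p]}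
    (hy : y ∈ fracAlg β) :
    ∃ (N : ℕ) (a : ℤ_[p][X]), (β : PowerSeries ℤ_[p]) ^ N * y = a := by
  induction hy using Algebra.adjoin_induction with
  | mem x hx =>
    rcases hx with rfl | rfl
    · exact ⟨0, X, by simp⟩
    · exact ⟨1, 1, by simp [beta_mul_inv hβ]⟩
  | algebraMap r => exact ⟨0, C r, by simp⟩
  | add x z _ _ hx hz =>
    obtain ⟨N, a, h1⟩ := hx
    obtain ⟨M, b, h2⟩ := hz
    refine ⟨N + M, β ^ M * a + β ^ N * b, ?_⟩
    push_cast
    rw [← h1, ← h2]; ring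
  | mul x z _ _ hx hz =>
    obtain ⟨N, a, h1⟩ := hx
    obtain ⟨M, b, h2⟩ := hz
    refine ⟨N + M, a * b, ?_⟩
    push_cast
    rw [← h1, ← h2]; ring

theorem p_ne : (p : PowerSeries ℤ_[p]) ≠ 0 := by
  intro h
  have := congrArg PowerSeries.constantCoeff h
  simp at this
  exact (Fact.out : p.Prime).ne_zero this

theorem saturated_frac {β : ℤ_[p][X]} (hβ : β.coeff 0 = 1) {e : PowerSeries ℤ_[p]}
    (he : (p : PowerSeries ℤ_[p]) * e ∈ fracAlg β) : e ∈ fracAlg β := by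
  obtain ⟨N, a, h⟩ := exists_pow_mul hβ he
  have h1 : ∀ k, (p : ℤ_[p]) ∣ a.coeff k := by
    intro k
    rw [← Polynomial.coeff_coe, ← h, show (β : PowerSeries ℤ_[p]) ^ N * (p * e) =
      p • ((β : PowerSeries ℤ_[p]) ^ N * e) by rw [nsmul_eq_mul]; ring, map_nsmul, nsmul_eq_mul]
    exact dvd_mul_right _ _
  obtain ⟨b, hb⟩ := (Polynomial.C_dvd_iff_dvd_coeff _ _).2 h1
  have h2 : (β : PowerSeries ℤ_[p]) ^ N * e = b := by
    apply mul_left_cancel₀ p_ne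
    have : (a : PowerSeries ℤ_[p]) = p * b := by
      rw [hb]; push_cast; simp
    rw [← this, ← h]; ring
  have h3 : e = b * PowerSeries.invOfUnit (β : PowerSeries ℤ_[p]) 1 ^ N := by
    rw [← h2, mul_right_comm, ← mul_pow, beta_mul_inv hβ, one_pow, one_mul]
  rw [h3]
  exact mul_mem (coe_mem β b) (pow_mem (inv_mem β) N)

theorem saturated {β : ℤ_[p][X]} (hβ : β.coeff 0 = 1) {e : PowerSeries ℤ_[p]}
    (he : (p : PowerSeries ℤ_[p]) * e ∈ completedAlg β) : e ∈ completedAlg β := by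
  intro s
  obtain ⟨y, hy, c, hc⟩ := he (s + 1)
  refine ⟨e - p ^ s * c, saturated_frac hβ ?_, by simp⟩
  have : (p : PowerSeries ℤ_[p]) * (e - p ^ s * c) = y := by
    linear_combination hc
  rwa [this]

theorem mem_of_closed {β : ℤ_[p][X]} {h : PowerSeries ℤ_[p]}
    (hh : ∀ s : ℕ, ∃ y ∈ completedAlg β, (p : PowerSeries ℤ_[p]) ^ s ∣ h - y) :
    h ∈ completedAlg β := by
  intro s
  obtain ⟨y, hy, h1⟩ := hh s
  obtain ⟨z, hz, h2⟩ := hy s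
  exact ⟨z, hz, by simpa using dvd_add h1 h2⟩

theorem substPow_coe (a : ℤ_[p][X]) :
    substPow p (a : PowerSeries ℤ_[p]) = (Polynomial.expand ℤ_[p] p a : ℤ_[p][X]) := by
  induction a using Polynomial.induction_on' with
  | add a b ha hb => simp [ha, hb]
  | monomial k c =>
    rw [Polynomial.coe_monomial, substPow, PowerSeries.expand_monomial, Polynomial.expand_monomial,
      Polynomial.coe_monomial, mul_comm]

theorem substPow_inv_mem {β : ℤ_[p][X]} (hβ : β.coeff 0 = 1) :
    substPow p (PowerSeries.invOfUnit (β : PowerSeries ℤ_[p]) 1) ∈ completedAlg β := by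
  set b := (β : PowerSeries ℤ_[p])
  set i := PowerSeries.invOfUnit b 1
  have hbi : b * i = 1 := beta_mul_inv hβ
  have hs : substPow p b * substPow p i = 1 := by rw [← map_mul, hbi, map_one]
  have hb' : substPow p b ∈ fracAlg β := by
    have : substPow p b = (Polynomial.expand ℤ_[p] p β : ℤ_[p][X]) := by
      exact substPow_coe β
    rw [this]
    exact coe_mem _ _
  obtain ⟨E, hE⟩ := dvd_substPow_sub b
  have hEm : E ∈ fracAlg β := by
    apply saturated_frac hβ
    rw [← hE]
    exact sub_mem hb' (pow_mem (coe_mem β β) p)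
  have hbp : b ^ p * i ^ p = 1 := by rw [← mul_pow, hbi, one_pow]
  intro s
  refine ⟨i ^ p * ∑ k ∈ Finset.range s, (-(p * E * i ^ p)) ^ k, ?_, ?_⟩
  · refine mul_mem (pow_mem (inv_mem β) p) (sum_mem fun k _ => pow_mem (neg_mem ?_) k)
    exact mul_mem (mul_mem (natCast_mem _ p) hEm) (pow_mem (inv_mem β) p)
  · have hg := geom_sum_mul_neg (-(p * E * i ^ p)) s
    set G := ∑ k ∈ Finset.range s, (-(p * E * i ^ p)) ^ k
    have h1 : substPow p b * (i ^ p * G) = 1 - (-(p * E * i ^ p)) ^ s := by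
      rw [← hg, show substPow p b = b ^ p + p * E by rw [← hE]; ring]
      linear_combination G * hbp
    have h2 : substPow p i - i ^ p * G = (-(p * E * i ^ p)) ^ s * substPow p i := by
      linear_combination (-substPow p i) * h1 + (i ^ p * G) * hs
    rw [h2]
    refine Dvd.dvd.mul_right ?_ _
    rw [show -(p * E * i ^ p) = p * (-(E * i ^ p)) by ring, mul_pow]
    exact dvd_mul_right _ _

theorem substPow_mem {β : ℤ_[p][X]} (hβ : β.coeff 0 = 1) {h : PowerSeries ℤ_[p]}
    (hh : h ∈ completedAlg β) : substPow p h ∈ completedAlg β := by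
  apply mem_of_closed
  intro s
  obtain ⟨y, hy, c, hc⟩ := hh s
  refine ⟨substPow p y, ?_, substPow p c, ?_⟩
  · have : fracAlg β ≤ (completedAlg β).comap (substPow p) := by
      apply Algebra.adjoin_le
      rintro x (rfl | rfl)
      · change substPow p PowerSeries.X ∈ completedAlg β
        rw [substPow, PowerSeries.expand_X]
        exact fracAlg_le β (pow_mem (X_mem β) p)
      · exact substPow_inv_mem hβ
    exact this hy
  · rw [← map_sub, hc, map_mul, map_pow, map_natCast]

/-- The ring endomorphism `h(t) ↦ h(t^p)` of the `p`-adic completion of `ℤ_p[t, β(t)⁻¹]`. -/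
def frobeniusHom {β : ℤ_[p][X]} (hβ : β.coeff 0 = 1) : completedAlg β →+* completedAlg β where
  toFun h := ⟨substPow p (h : PowerSeries ℤ_[p]), substPow_mem hβ h.2⟩
  map_one' := Subtype.ext (map_one (substPow p))
  map_mul' a b := Subtype.ext (map_mul (substPow p) (a : PowerSeries ℤ_[p]) b)
  map_zero' := Subtype.ext (map_zero (substPow p))
  map_add' a b := Subtype.ext (map_add (substPow p) (a : PowerSeries ℤ_[p]) b)

/-- `h(t) ↦ h(t^p)` is a Frobenius lift. -/
def frobeniusT {β : ℤ_[p][X]} (hβ : β.coeff 0 = 1) : FrobeniusLift p (completedAlg β) where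
  toRingHom := frobeniusHom hβ
  dvd_sub := by
    intro r
    obtain ⟨e, he⟩ := dvd_substPow_sub (r : PowerSeries ℤ_[p])
    have hm : e ∈ completedAlg β := by
      apply saturated hβ
      rw [← he]
      exact sub_mem (substPow_mem hβ r.2) (pow_mem r.2 p)
    refine ⟨⟨e, hm⟩, Subtype.ext ?_⟩
    simpa [frobeniusHom] using he

end Completion

section Pencil

open Polynomial

variable {p : ℕ} [Fact p.Prime] {n : ℕ}

/-- The Laurent polynomial `1 - t g(x)` over a `ℤ_p`-algebra containing `t`. -/
def pencil {T : Type*} [CommRing T] [Algebra ℤ_[p] T] (t : T) (g : Laurent ℤ_[p] n) :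
    Laurent T n :=
  1 - t • AddMonoidAlgebra.mapRingHom (Fin n → ℤ) (algebraMap ℤ_[p] T) g

/-- `β_p(t)`: the constant term of `(1 - t g(x))^{p-1}`, a polynomial in `t`. -/
def beta (g : Laurent ℤ_[p] n) : ℤ_[p][X] := hasseWitt p (pencil X g) 0 0

theorem beta_coeff_zero (g : Laurent ℤ_[p] n) : (beta g).coeff 0 = 1 := by
  have h : AddMonoidAlgebra.mapRingHom (Fin n → ℤ) (Polynomial.constantCoeff (R := ℤ_[p]))
      (pencil X g ^ (p - 1)) = 1 := by
    have h0 : AddMonoidAlgebra.mapRingHom (Fin n → ℤ) (Polynomial.constantCoeff (R := ℤ_[p]))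
        (pencil X g) = 1 := by
      ext u
      simp [pencil]
    rw [map_pow, h0, one_pow]
  have h2 := congrArg (fun a : Laurent ℤ_[p] n => a.coeff 0) h
  rw [AddMonoidAlgebra.coeff_mapRingHom] at h2
  simpa [-map_pow, beta, hasseWitt, AddMonoidAlgebra.one_def] using h2

/-- The `p`-adic completion of `ℤ_p[t, β_p(t)⁻¹]`. -/
abbrev BaseRing (g : Laurent ℤ_[p] n) : Type := completedAlg (beta g)

/-- The element `t`. -/
def tElt (g : Laurent ℤ_[p] n) : BaseRing g := ⟨PowerSeries.X, fracAlg_le _ (X_mem _)⟩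

/-- The Frobenius lift `t ↦ t^p`. -/
def sigma (g : Laurent ℤ_[p] n) : FrobeniusLift p (BaseRing g) := frobeniusT (beta_coeff_zero g)

/-- `f(x) = 1 - t g(x)`. -/
def fPoly (g : Laurent ℤ_[p] n) : Laurent (BaseRing g) n := pencil (tElt g) g

/-- `q(t) = ∑ b_k t^k`, where `b_k` is the constant term of `g(x)^k`. -/
def qSeries (g : Laurent ℤ_[p] n) : PowerSeries ℤ_[p] :=
  PowerSeries.mk fun k => (g ^ k).coeff 0

end Pencil

end DworkCrystal

end

open DworkCrystal

/-! Everything rests on the congruence f^σ(x^p) = f^p + pG with G supported in pΔ. If k ≤ p(m+1),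
then a/f^k = a f^{p(m+1)-k} / (f^σ(x^p) - pG)^{m+1}, and the binomial series gives 𝒞_p(a/f^k) = ∑_r
C(m+r,m) p^r 𝒞_p(a f^{p(m+1)-k} G^r) / (f^σ)^{m+1+r} (`cartierLevel_frac`). If a is supported in
kΔ°, the r-th numerator is supported in (m+1+r)Δ°. For 1/f and m = 0 the leading term is β_p/f^σ,
because 0 is the only lattice point of Δ°; and β_p is a unit of R.

The link with q is the constant term in x of the expansion in powers of t. It is unchanged by 𝒞_p
(`dvd_constFrac_sub`, `constHat_cartier`), and it takes 1/f to q(t) and 1/f^σ to q(t^p).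

For the ratio, constant terms alone suffice, and p = 2 is allowed: induction on s (`const_mod_pow`)
shows that q(t)/q(t^p) is congruent modulo p^s to an element of R, and R is p-adically closed in
ℤ_p⟦t⟧.

For odd p, p^r/r! is divisible by p^⌈r/2⌉, so the series is compatible with the factorials in Ω, and
𝒞_p maps the completed Ω_f into R·(1/f^σ) plus p times the completed Ω_{f^σ}
(`UnitRootClass.cartier_eq`). As every β_p + pl is a unit, successive approximation subtracts from y
a multiple l_s/f so that 𝒞_p^s of the rest is divisible by p^s
(`UnitRootClass.exists_sub_mem_cartierKer`). Since q is a unit, constant terms force the l_s to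
converge and make the limit unique: this is freeness of rank one. Applied to 𝒞_p(1/f) - l/f^σ in U,
they give q(t) = l q(t^p), hence l = Λ. -/

noncomputable section

namespace DworkCrystal

/-! ### Truncated binomial series and the Cartier operator on a/h^k. -/

section Algebra

/-- Pascal's rule in truncated form: multiplying the series of (X - Y)^{-(m+2)} by X - Y gives that
of (X - Y)^{-(m+1)}, up to one boundary term. It is the induction step of the next lemma. -/
theorem sub_mul_sum_choose {A : Type*} [CommRing A] (X Y : A) (m M : ℕ) :
    (X - Y) * ∑ r ∈ Finset.range M, ((m + 1 + r).choose (m + 1) : A) * Y ^ r * X ^ (M - r) +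
        ((m + M).choose (m + 1) : A) * Y ^ M * X =
      X * ∑ r ∈ Finset.range M, ((m + r).choose m : A) * Y ^ r * X ^ (M - r) := by
  have step : ∀ (c : ℕ → A) (M : ℕ), ∑ r ∈ Finset.range (M + 1), c r * Y ^ r * X ^ (M + 1 - r) =
      X * ∑ r ∈ Finset.range M, c r * Y ^ r * X ^ (M - r) + c M * Y ^ M * X := by
    intro c M
    rw [Finset.sum_range_succ, Finset.mul_sum]
    congr 1
    · refine Finset.sum_congr rfl fun r hr => ?_
      rw [Nat.sub_add_comm (Finset.mem_range.1 hr).le, pow_succ]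
      ring
    · simp
  induction M with
  | zero => simp
  | succ M ih =>
    rw [step (fun r => ((m + 1 + r).choose (m + 1) : A)), step (fun r => ((m + r).choose m : A))]
    have h : ((m + 1 + M).choose (m + 1) : A) =
        ((m + M).choose m : A) + ((m + M).choose (m + 1) : A) := by
      rw [show m + 1 + M = m + M + 1 by ring, Nat.choose_succ_succ]
      push_cast
      ring
    rw [show m + (M + 1) = m + 1 + M by ring, h]
    linear_combination X * ih

/-- The binomial series for `(X - Y)^{-(m+1)}`, truncated. -/
theorem pow_dvd_sub_mul_sum_choose {A : Type*} [CommRing A] (X Y : A) (m M : ℕ) :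
    Y ^ M ∣ X ^ (m + 1 + M) - (X - Y) ^ (m + 1) *
      ∑ r ∈ Finset.range M, ((m + r).choose m : A) * Y ^ r * X ^ (M - r) := by
  induction m with
  | zero =>
    have h := (Commute.all Y X).geom_sum₂_mul M
    refine ⟨X, ?_⟩
    have h1 : ∑ r ∈ Finset.range M, ((0 + r).choose 0 : A) * Y ^ r * X ^ (M - r) =
        X * ∑ r ∈ Finset.range M, Y ^ r * X ^ (M - 1 - r) := by
      rw [Finset.mul_sum]
      refine Finset.sum_congr rfl fun r hr => ?_
      have : M - r = (M - 1 - r) + 1 := by have := Finset.mem_range.1 hr; omega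
      rw [this, pow_succ]
      simp
      ring
    rw [h1, zero_add, pow_one, pow_add, pow_one]
    linear_combination X * h
  | succ m ih =>
    have h := sub_mul_sum_choose X Y m M
    obtain ⟨w, hw⟩ := ih
    refine ⟨X * w + (X - Y) ^ (m + 1) * ((m + M).choose (m + 1) : A) * X, ?_⟩
    rw [pow_succ (X - Y) (m + 1), show m + 1 + 1 + M = (m + 1 + M) + 1 by ring, pow_succ]
    linear_combination X * hw - (X - Y) ^ (m + 1) * h

variable {p : ℕ} {R : Type*} [CommRing R] {n : ℕ}

/-- `a ↦ a / f^k` as a linear map. -/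
def fracLin (f : Laurent R n) (k : ℕ) : Laurent R n →ₗ[R] Frac f where
  toFun a := frac f a k
  map_add' a b := by simp [frac, Localization.add_mk_self]
  map_smul' c a := by simp [frac, Localization.smul_mk]

theorem fracLin_apply (f : Laurent R n) (k : ℕ) (a : Laurent R n) :
    fracLin f k a = frac f a k := rfl

theorem frac_mul_pow (f a : Laurent R n) (k j : ℕ) : frac f (a * f ^ j) (k + j) = frac f a k := by
  rw [frac, frac, Localization.mk_eq_mk_iff, Localization.r_iff_exists]
  exact ⟨1, by simp; ring⟩

/-- With F = h^σ(x^p), one has h^{p^(s+1)} ≡ F^{p^s} modulo p^s, so the hypothesis says a/h^k ≡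
B/F^N with denominators cleared; powers of F then pass through the Cartier operation as powers of
h^σ. -/
theorem cartierLevel_frac_of_dvd [Fact p.Prime] (σ : FrobeniusLift p R) (h a B : Laurent R n)
    (k N s : ℕ) (H : (p : Laurent R n) ^ s ∣ a * h ^ (k * (p ^ (s + 1) - 1)) *
      inflate p R n (twist σ h) ^ N - B * inflate p R n (twist σ h) ^ (k * p ^ s)) :
    cartierLevel σ h s (frac h a k) =
      Submodule.Quotient.mk (frac (twist σ h) (decimate p R n B) N) := by
  change (Submodule.Quotient.mk (Localization.mk _ _) : ModPow p R (Frac (twist σ h)) s) = _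
  apply mkQ_eq_of_dvd s _ _ _ _ 1
  simp only [Submonoid.coe_one, one_mul, map_pow, ← pow_mul]
  have := dvd_decimate s H
  rw [map_sub, mul_comm _ (inflate p R n _ ^ N), mul_comm B, ← map_pow (inflate p R n),
    ← map_pow (inflate p R n), decimate_inflate_mul, decimate_inflate_mul] at this
  convert this using 2 <;> ring

/-- The Cartier operator on `a/h^k`, expanded modulo `p^s`. -/
theorem cartierLevel_frac [Fact p.Prime] (σ : FrobeniusLift p R) (h a G : Laurent R n)
    (hG : inflate p R n (twist σ h) = h ^ p + p * G) {k m : ℕ} (hk : k ≤ p * (m + 1)) (s : ℕ) :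
    cartierLevel σ h s (frac h a k) = Submodule.Quotient.mk (∑ r ∈ Finset.range s,
      (((m + r).choose m * p ^ r : ℕ) : R) • frac (twist σ h)
        (decimate p R n (a * h ^ (p * (m + 1) - k) * G ^ r)) (m + 1 + r)) := by
  set F := inflate p R n (twist σ h) with hF
  -- The truncated series for a h^{p(m+1)-k} / (F - pG)^{m+1}, brought to the common denominator
  -- F^{m+1+s}; the error is divisible by (pG)^s.
  set B := a * h ^ (p * (m + 1) - k) *
    ∑ r ∈ Finset.range s, ((m + r).choose m : Laurent R n) * (p * G) ^ r * F ^ (s - r) with hB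
  rw [cartierLevel_frac_of_dvd σ h a B k (m + 1 + s) s]
  · congr 1
    rw [hB, Finset.mul_sum, ← fracLin_apply, map_sum, map_sum]
    refine Finset.sum_congr rfl fun r hr => ?_
    have h1 : a * h ^ (p * (m + 1) - k) * (((m + r).choose m : Laurent R n) * (p * G) ^ r *
        F ^ (s - r)) = (((m + r).choose m * p ^ r : ℕ) : R) • (inflate p R n (twist σ h ^ (s - r)) *
          (a * h ^ (p * (m + 1) - k) * G ^ r)) := by
      rw [map_pow, ← hF, Algebra.smul_def, map_natCast]
      push_cast
      ring
    rw [h1, map_smul, map_smul, decimate_inflate_mul, fracLin_apply,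
      mul_comm (twist σ h ^ (s - r)),
      show m + 1 + s = m + 1 + r + (s - r) by have := Finset.mem_range.1 hr; omega, frac_mul_pow]
  · obtain ⟨w, hw⟩ := pow_dvd_sub_mul_sum_choose F (p * G) m s
    rw [show F - p * G = h ^ p by rw [hG]; ring] at hw
    have h0 : (p : Laurent R n) ∣ F - h ^ p := ⟨G, by rw [hG]; ring⟩
    have h1 := dvd_sub_pow_of_dvd_sub h0 s
    rw [← pow_mul, ← pow_succ'] at h1
    have h2 : (p : Laurent R n) ^ s ∣ F ^ (k * p ^ s) - h ^ (k * p ^ (s + 1)) := by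
      rw [mul_comm k, mul_comm k, pow_mul, pow_mul]
      exact ((pow_dvd_pow _ (Nat.le_succ s)).trans h1).trans (sub_dvd_pow_sub_pow _ _ k)
    obtain ⟨v, hv⟩ := h2
    have hB' : B * F ^ (k * p ^ s) = B * h ^ (k * p ^ (s + 1)) + p ^ s * (B * v) := by
      linear_combination B * hv
    have hpos : 1 ≤ p ^ (s + 1) := Nat.one_le_pow _ _ (Fact.out : p.Prime).pos
    have e1 : k * p ^ (s + 1) = k * (p ^ (s + 1) - 1) + k := by
      rw [Nat.mul_sub, mul_one, Nat.sub_add_cancel (Nat.le_mul_of_pos_right k hpos)]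
    have e2 : h ^ (p * (m + 1) - k) * h ^ (k * p ^ (s + 1)) =
        h ^ (k * (p ^ (s + 1) - 1)) * (h ^ p) ^ (m + 1) := by
      rw [← pow_mul, ← pow_add, ← pow_add]
      congr 1
      omega
    refine ⟨a * h ^ (k * (p ^ (s + 1) - 1)) * G ^ s * w - B * v, ?_⟩
    rw [hB', hB]
    rw [mul_pow] at hw
    linear_combination a * h ^ (k * (p ^ (s + 1) - 1)) * hw -
      a * (∑ r ∈ Finset.range s, ((m + r).choose m : Laurent R n) * (p * G) ^ r * F ^ (s - r)) * e2

end Algebra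

/-! ### Supports of Laurent polynomials and dilates of the polytope. -/

section Support

variable {p : ℕ} {R : Type*} [CommRing R] {n : ℕ}

/-- The exponents of `a` lie in `S`. -/
def SuppIn (a : Laurent R n) (S : Set (Fin n → ℝ)) : Prop :=
  ∀ u ∈ a.coeff.support, toReal u ∈ S

theorem toReal_add (u v : Fin n → ℤ) : toReal (u + v) = toReal u + toReal v := by
  ext i; simp [toReal]

theorem toReal_nsmul (k : ℕ) (u : Fin n → ℤ) : toReal (k • u) = (k : ℝ) • toReal u := by
  ext i; simp [toReal]

theorem toReal_zero : toReal (0 : Fin n → ℤ) = 0 := by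
  ext i; simp [toReal]

theorem SuppIn.mono {a : Laurent R n} {S T : Set (Fin n → ℝ)} (ha : SuppIn a S) (h : S ⊆ T) :
    SuppIn a T := fun u hu => h (ha u hu)

theorem SuppIn.mul {a b : Laurent R n} {S T : Set (Fin n → ℝ)} (ha : SuppIn a S)
    (hb : SuppIn b T) : SuppIn (a * b) (S + T) := by
  classical
  intro u hu
  obtain ⟨v, hv, w, hw, rfl⟩ := Finset.mem_add.1 (AddMonoidAlgebra.support_coeff_mul_subset a b hu)
  rw [toReal_add]
  exact Set.add_mem_add (ha v hv) (hb w hw)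

theorem suppIn_one {S : Set (Fin n → ℝ)} (hS : (0 : Fin n → ℝ) ∈ S) :
    SuppIn (1 : Laurent R n) S := by
  intro u hu
  rw [AddMonoidAlgebra.one_def, AddMonoidAlgebra.coeff_single] at hu
  have := Finset.mem_singleton.1 (Finsupp.support_single_subset hu)
  rw [this, toReal_zero]
  exact hS

theorem SuppIn.add {a b : Laurent R n} {S : Set (Fin n → ℝ)} (ha : SuppIn a S) (hb : SuppIn b S) :
    SuppIn (a + b) S := by
  classical
  intro u hu
  rw [AddMonoidAlgebra.coeff_add] at hu
  rcases Finset.mem_union.1 (Finsupp.support_add hu) with h | h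
  exacts [ha u h, hb u h]

theorem SuppIn.neg {a : Laurent R n} {S : Set (Fin n → ℝ)} (ha : SuppIn a S) : SuppIn (-a) S := by
  intro u hu
  apply ha u
  simpa using hu

theorem SuppIn.pow {a : Laurent R n} {Δ : Set (Fin n → ℝ)} (hΔ : Convex ℝ Δ)
    (h0 : (0 : Fin n → ℝ) ∈ Δ) (ha : SuppIn a Δ) (j : ℕ) : SuppIn (a ^ j) ((j : ℝ) • Δ) := by
  induction j with
  | zero =>
    rw [pow_zero]
    exact suppIn_one ⟨0, h0, by simp⟩
  | succ j ih =>
    rw [pow_succ]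
    refine (ih.mul ha).mono ?_
    push_cast
    rw [hΔ.add_smul (Nat.cast_nonneg j) zero_le_one, one_smul]

/-- A convex combination giving positive weight to an interior point is interior; k ≥ 1 makes that
weight positive. -/
theorem add_subset_smul_interior {Δ : Set (Fin n → ℝ)} (hΔ : Convex ℝ Δ) {k : ℕ} (hk : 1 ≤ k)
    (j : ℕ) : (k : ℝ) • interior Δ + (j : ℝ) • Δ ⊆ ((k + j : ℕ) : ℝ) • interior Δ := by
  rintro _ ⟨_, ⟨x, hx, rfl⟩, _, ⟨y, hy, rfl⟩, rfl⟩
  have hk' : (0 : ℝ) < k := by exact_mod_cast hk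
  have hs : (0 : ℝ) < (k + j : ℝ) := by positivity
  refine ⟨(k / (k + j : ℝ)) • x + (j / (k + j : ℝ)) • y, ?_, ?_⟩
  · exact hΔ.combo_interior_self_mem_interior hx hy (by positivity) (by positivity)
      (by field_simp)
  · push_cast
    simp only [smul_add, smul_smul]
    congr 2 <;> field_simp

theorem SuppIn.mul_interior {a b : Laurent R n} {Δ : Set (Fin n → ℝ)} (hΔ : Convex ℝ Δ)
    {k j : ℕ} (hk : 1 ≤ k) (ha : SuppIn a ((k : ℝ) • interior Δ)) (hb : SuppIn b ((j : ℝ) • Δ)) :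
    SuppIn (a * b) (((k + j : ℕ) : ℝ) • interior Δ) :=
  (ha.mul hb).mono (add_subset_smul_interior hΔ hk j)

theorem SuppIn.decimate [Fact p.Prime] {a : Laurent R n} {S : Set (Fin n → ℝ)} {m : ℕ}
    (ha : SuppIn a (((p * m : ℕ) : ℝ) • S)) : SuppIn (decimate p R n a) ((m : ℝ) • S) := by
  intro u hu
  have hp : (p : ℝ) ≠ 0 := by exact_mod_cast (Fact.out : p.Prime).ne_zero
  obtain ⟨x, hx, h⟩ := ha (p • u) (by
    rw [Finsupp.mem_support_iff] at hu ⊢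
    exact hu)
  refine ⟨x, hx, ?_⟩
  simp only [toReal_nsmul] at h
  push_cast at h
  rw [mul_smul] at h
  exact smul_right_injective _ hp h

theorem SuppIn.inflate [Fact p.Prime] {a : Laurent R n} {S : Set (Fin n → ℝ)}
    (ha : SuppIn a S) : SuppIn (inflate p R n a) ((p : ℝ) • S) := by
  classical
  intro u hu
  have : u ∈ (Finsupp.mapDomain (fun v : Fin n → ℤ => p • v) a.coeff).support := hu
  obtain ⟨v, hv, rfl⟩ := Finset.mem_image.1 (Finsupp.mapDomain_support this)
  simp only [toReal_nsmul]
  exact Set.smul_mem_smul_set (ha v hv)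

theorem SuppIn.twist {σ : FrobeniusLift p R} {a : Laurent R n} {S : Set (Fin n → ℝ)}
    (ha : SuppIn a S) : SuppIn (twist σ a) S := by
  intro u hu
  apply ha u
  rw [Finsupp.mem_support_iff] at hu ⊢
  intro h
  apply hu
  simp [DworkCrystal.twist, h]

theorem SuppIn.of_natCast_mul {a : Laurent R n} {S : Set (Fin n → ℝ)}
    (hp : ∀ r : R, (p : R) * r = 0 → r = 0) (ha : SuppIn ((p : Laurent R n) * a) S) :
    SuppIn a S := by
  intro u hu
  apply ha u
  rw [Finsupp.mem_support_iff] at hu ⊢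
  intro h
  apply hu
  apply hp
  rw [← nsmul_eq_mul, AddMonoidAlgebra.coeff_smul] at h
  rw [← nsmul_eq_mul]
  exact h

end Support

/-! ### Congruences modulo p^s in a module. -/

section AdicLemmas

variable {p : ℕ} {R : Type*} [CommRing R] {M : Type*} [AddCommGroup M] [Module R M]

theorem mem_span_pow_smul_top (s : ℕ) (x : M) :
    x ∈ (Ideal.span {(p : R)} ^ s • (⊤ : Submodule R M)) ↔ ∃ y : M, x = (p : R) ^ s • y := by
  rw [Ideal.span_singleton_pow, Submodule.ideal_span_singleton_smul,
    Submodule.mem_smul_pointwise_iff_exists]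
  simp [eq_comm]

theorem mk_eq_mk_iff_exists {s : ℕ} {x y : M} :
    (Submodule.Quotient.mk x : ModPow p R M s) = Submodule.Quotient.mk y ↔
      ∃ z : M, x - y = (p : R) ^ s • z := by
  rw [Submodule.Quotient.eq, mem_span_pow_smul_top]

end AdicLemmas

/-! ### Expansion in powers of t and the constant term in x. -/

section Expansion

variable {p : ℕ} {A R : Type*} [CommRing A] [CommRing R] [Algebra R (PowerSeries A)] {n : ℕ}

/-- Laurent polynomials over a ring of power series in `t`, seen as power series in `t` with
Laurent polynomials as coefficients. -/
def expandT (A : Type*) {R : Type*} [CommRing A] [CommRing R] [Algebra R (PowerSeries A)] (n : ℕ) :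
    Laurent R n →+* PowerSeries (Laurent A n) :=
  AddMonoidAlgebra.liftNCRingHom
    ((PowerSeries.map (algebraMap A (Laurent A n))).comp (algebraMap R (PowerSeries A)))
    ((PowerSeries.C : Laurent A n →+* PowerSeries (Laurent A n)).toMonoidHom.comp
      (AddMonoidAlgebra.of A (Fin n → ℤ)))
    (fun _ _ => Commute.all _ _)

theorem expandT_single (u : Fin n → ℤ) (r : R) : expandT A n (AddMonoidAlgebra.single u r) =
    PowerSeries.map (algebraMap A (Laurent A n)) (algebraMap R (PowerSeries A) r) *
      PowerSeries.C (AddMonoidAlgebra.single u 1) := by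
  simp [expandT, AddMonoidAlgebra.liftNCRingHom]

theorem coeff_expandT (a : Laurent R n) (k : ℕ) (u : Fin n → ℤ) :
    (PowerSeries.coeff k (expandT A n a)).coeff u =
      PowerSeries.coeff k (algebraMap R (PowerSeries A) (a.coeff u)) := by
  classical
  induction a using AddMonoidAlgebra.induction_linear with
  | zero => simp
  | add x y hx hy => simp [hx, hy]
  | single v r =>
    rw [expandT_single, PowerSeries.coeff_mul_C, PowerSeries.coeff_map,
      AddMonoidAlgebra.coe_algebraMap]
    simp only [Function.comp_apply, AddMonoidAlgebra.single_mul_single, AddMonoidAlgebra.coeff_single,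
      Finsupp.single_apply]
    by_cases h : v = u <;> simp [h]

/-- The Cartier operation on the coefficients of a power series. -/
def decimateT (p : ℕ) [Fact p.Prime] (y : PowerSeries (Laurent A n)) : PowerSeries (Laurent A n) :=
  PowerSeries.mk fun k => decimate p A n (PowerSeries.coeff k y)

theorem decimateT_expandT [Fact p.Prime] (a : Laurent R n) :
    decimateT p (expandT A n a) = expandT A n (decimate p R n a) := by
  ext k u
  rw [decimateT, PowerSeries.coeff_mk, decimate_coeff, coeff_expandT, coeff_expandT,
    decimate_coeff]

/-- Inflation and decimation act on x only, so the projection formula holds term by term in the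
convolution over powers of t. -/
theorem decimateT_inflate_mul [Fact p.Prime] (b y : PowerSeries (Laurent A n)) :
    decimateT p (PowerSeries.map (inflate p A n) b * y) = b * decimateT p y := by
  ext1 k
  rw [decimateT, PowerSeries.coeff_mk, PowerSeries.coeff_mul, PowerSeries.coeff_mul, map_sum]
  refine Finset.sum_congr rfl fun i _ => ?_
  rw [PowerSeries.coeff_map, decimate_inflate_mul, decimateT, PowerSeries.coeff_mk]

theorem map_inflate_expandT (b : Laurent R n) :
    PowerSeries.map (inflate p A n) (expandT A n b) = expandT A n (inflate p R n b) := by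
  induction b using AddMonoidAlgebra.induction_linear with
  | zero => simp
  | add x y hx hy => simp [hx, hy]
  | single u r =>
    have h : inflate p R n (AddMonoidAlgebra.single u r) = AddMonoidAlgebra.single (p • u) r := by
      simp [inflate]
    rw [h, expandT_single, expandT_single, map_mul, PowerSeries.map_C]
    congr 1
    · rw [← RingHom.comp_apply, ← PowerSeries.map_comp]
      congr 2
      ext1 x
      simp [inflate, AddMonoidAlgebra.coe_algebraMap]
    · congr 1
      simp [inflate]

/-- The constant term in `x`. -/
def constTerm : PowerSeries (Laurent A n) →+ PowerSeries A where
  toFun y := PowerSeries.mk fun k => (PowerSeries.coeff k y).coeff 0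
  map_zero' := by ext; simp
  map_add' _ _ := by ext; simp

theorem coeff_constTerm (y : PowerSeries (Laurent A n)) (k : ℕ) :
    PowerSeries.coeff k (constTerm y) = (PowerSeries.coeff k y).coeff 0 := by
  simp [constTerm]

theorem constTerm_decimateT [Fact p.Prime] (y : PowerSeries (Laurent A n)) :
    constTerm (decimateT p y) = constTerm y := by
  ext k
  rw [coeff_constTerm, coeff_constTerm, decimateT, PowerSeries.coeff_mk, decimate_coeff, smul_zero]

theorem constTerm_map_mul (r : PowerSeries A) (y : PowerSeries (Laurent A n)) :
    constTerm (PowerSeries.map (algebraMap A (Laurent A n)) r * y) = r * constTerm y := by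
  ext k
  rw [coeff_constTerm, PowerSeries.coeff_mul, PowerSeries.coeff_mul]
  rw [AddMonoidAlgebra.coeff_sum, Finsupp.finsetSum_apply]
  refine Finset.sum_congr rfl fun i _ => ?_
  rw [PowerSeries.coeff_map, coeff_constTerm, ← Algebra.smul_def, AddMonoidAlgebra.coeff_smul]
  rfl

theorem dvd_constTerm_sub {c : ℕ} {x y : PowerSeries (Laurent A n)}
    (h : (c : PowerSeries (Laurent A n)) ∣ x - y) :
    (c : PowerSeries A) ∣ constTerm x - constTerm y := by
  obtain ⟨z, hz⟩ := h
  refine ⟨constTerm z, ?_⟩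
  rw [← map_sub, hz, ← nsmul_eq_mul, map_nsmul, nsmul_eq_mul]

/-- The expansion in powers of `t` of a rational function whose denominator has an invertible
expansion. -/
def expandFrac (h : Laurent R n) (hu : IsUnit (expandT A n h)) :
    Frac h →+* PowerSeries (Laurent A n) :=
  IsLocalization.Away.lift h hu

theorem expandFrac_mk_mul (h : Laurent R n) (hu : IsUnit (expandT A n h)) (a : Laurent R n)
    (b : Submonoid.powers h) :
    expandFrac h hu (Localization.mk a b) * expandT A n (b : Laurent R n) = expandT A n a := by
  have h1 : ∀ c, expandFrac h hu (algebraMap _ _ c) = expandT A n c :=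
    fun c => IsLocalization.Away.lift_eq h hu c
  rw [← h1 b, ← map_mul, ← h1 a]
  congr 1
  rw [Localization.mk_eq_mk']
  exact IsLocalization.mk'_spec _ _ _

theorem expandFrac_smul (h : Laurent R n) (hu : IsUnit (expandT A n h)) (r : R) (z : Frac h) :
    expandFrac h hu (r • z) = PowerSeries.map (algebraMap A (Laurent A n))
      (algebraMap R (PowerSeries A) r) * expandFrac h hu z := by
  have h1 : ∀ c, expandFrac h hu (algebraMap _ _ c) = expandT A n c :=
    fun c => IsLocalization.Away.lift_eq h hu c
  rw [Algebra.smul_def, map_mul, IsScalarTower.algebraMap_apply R (Laurent R n) (Frac h), h1,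
    AddMonoidAlgebra.coe_algebraMap, Function.comp_apply, expandT_single]
  simp [← AddMonoidAlgebra.one_def]

/-- The constant term in `x` of the expansion in powers of `t` of a rational function. -/
def constFrac (h : Laurent R n) (hu : IsUnit (expandT A n h)) : Frac h →ₗ[R] PowerSeries A where
  toFun z := constTerm (expandFrac h hu z)
  map_add' x y := by rw [map_add, map_add]
  map_smul' r x := by
    rw [expandFrac_smul, constTerm_map_mul, ← Algebra.smul_def, RingHom.id_apply]

theorem isUnit_expandT_twist_of_mem {σ : FrobeniusLift p R} {h : Laurent R n}
    (hu : IsUnit (expandT A n (twist σ h))) (b : Submonoid.powers h) :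
    IsUnit (expandT A n (twist σ (b : Laurent R n))) := by
  obtain ⟨_, k, rfl⟩ := b
  rw [map_pow, map_pow]
  exact hu.pow k

/-- The Cartier operator preserves the constant term. -/
theorem dvd_constFrac_sub [Fact p.Prime] (σ : FrobeniusLift p R) {h : Laurent R n}
    (hu : IsUnit (expandT A n h)) (hu' : IsUnit (expandT A n (twist σ h))) {s : ℕ} {z : Frac h}
    {w : Frac (twist σ h)} (H : cartierLevel σ h s z = Submodule.Quotient.mk w) :
    (p : PowerSeries A) ^ s ∣ constFrac h hu z - constFrac (twist σ h) hu' w := by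
  induction z using Localization.induction_on with | _ x
  obtain ⟨a, b⟩ := x
  set d : Submonoid.powers (twist σ h) := ⟨twist σ (b : Laurent R n) ^ p ^ s, twist_mem σ h b _⟩
    with hd
  set y := decimate p R n (a * (b : Laurent R n) ^ (p ^ (s + 1) - 1)) with hy
  change (Submodule.Quotient.mk (Localization.mk y d) : ModPow p R (Frac (twist σ h)) s) = _ at H
  obtain ⟨v, hv⟩ := mk_eq_mk_iff_exists.1 H
  have h1 : (p : PowerSeries A) ^ s ∣ constFrac (twist σ h) hu' (Localization.mk y d) -
      constFrac (twist σ h) hu' w := by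
    rw [← map_sub, hv, map_smul, Algebra.smul_def, map_pow, map_natCast]
    exact dvd_mul_right _ _
  rw [← sub_add_sub_cancel _ (constFrac (twist σ h) hu' (Localization.mk y d))]
  refine dvd_add ?_ h1
  rw [← Nat.cast_pow]
  obtain ⟨τ', hτ⟩ := (isUnit_expandT_twist_of_mem hu' b).exists_right_inv
  -- W is the expansion of 1/b^σ(x^p). The value of the Cartier operator modulo p^s is the
  -- decimation of W^{p^s} a b^{p^(s+1)-1}. Decimation fixes the exponent 0, and W^{p^s} b^{p^(s+1)}
  -- ≡ 1 modulo p^s, so the constant term is that of a/b.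
  set W := PowerSeries.map (inflate p A n) τ' with hW
  set Y := expandT A n (a * (b : Laurent R n) ^ (p ^ (s + 1) - 1)) with hY
  have hTW : expandT A n (inflate p R n (twist σ (b : Laurent R n))) * W = 1 := by
    rw [← map_inflate_expandT, hW, ← map_mul, hτ, map_one]
  have hE := expandFrac_mk_mul h hu a b
  have hE' := expandFrac_mk_mul (twist σ h) hu' y d
  have e1 : expandFrac (twist σ h) hu' (Localization.mk y d) = decimateT p (W ^ p ^ s * Y) := by
    rw [hW, ← map_pow, decimateT_inflate_mul, hY, decimateT_expandT, ← hE', hd]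
    dsimp only
    rw [map_pow, mul_left_comm, ← mul_pow, mul_comm τ', hτ, one_pow, mul_one]
  have e2 : constFrac (twist σ h) hu' (Localization.mk y d) = constTerm (W ^ p ^ s * Y) := by
    rw [← constTerm_decimateT (p := p), ← e1]
    rfl
  rw [e2]
  refine dvd_constTerm_sub (x := expandFrac h hu (Localization.mk a b)) ?_
  have hdvd := dvd_sub_pow_of_dvd_sub (dvd_inflate_twist_sub σ (b : Laurent R n)) s
  rw [← pow_mul, ← pow_succ'] at hdvd
  obtain ⟨v, hv⟩ := (pow_dvd_pow _ (Nat.le_succ s)).trans hdvd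
  have hv' := congrArg (expandT A n) hv
  simp only [map_sub, map_mul, map_pow, map_natCast] at hv'
  have hN : p ^ (s + 1) - 1 + 1 = p ^ (s + 1) :=
    Nat.sub_add_cancel (Nat.one_le_pow _ _ (Fact.out : p.Prime).pos)
  have hY' : Y = expandFrac h hu (Localization.mk a b) *
      expandT A n (b : Laurent R n) ^ p ^ (s + 1) := by
    rw [hY, map_mul, map_pow, ← hE, ← hN, pow_succ]
    simp only [Nat.add_sub_cancel]
    ring
  have hTW' : expandT A n (inflate p R n (twist σ (b : Laurent R n))) ^ p ^ s * W ^ p ^ s = 1 := by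
    rw [← mul_pow, hTW, one_pow]
  refine ⟨expandFrac h hu (Localization.mk a b) * W ^ p ^ s * expandT A n v, ?_⟩
  rw [hY']
  push_cast
  linear_combination (expandFrac h hu (Localization.mk a b) * W ^ p ^ s) * hv' -
    expandFrac h hu (Localization.mk a b) * hTW'

/-- The constant term in `x`, extended to the `p`-adic completions. -/
def constHat (p : ℕ) (h : Laurent R n) (hu : IsUnit (expandT A n h)) :
    Compl p R (Frac h) →ₗ[R] Compl p R (PowerSeries A) :=
  (AdicCompletion.map (Ideal.span {(p : R)}) (constFrac h hu)).restrictScalars R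

theorem constHat_of (h : Laurent R n) (hu : IsUnit (expandT A n h)) (z : Frac h) :
    constHat p h hu (AdicCompletion.of _ _ z) = AdicCompletion.of _ _ (constFrac h hu z) :=
  AdicCompletion.map_of _ _ _

theorem cartier_val [Fact p.Prime] (σ : FrobeniusLift p R) (h : Laurent R n)
    (y : Compl p R (Frac h)) (s : ℕ) : (cartier σ h y).val s = cartierMod σ h s (y.val s) := rfl

theorem cartier_of_val [Fact p.Prime] (σ : FrobeniusLift p R) (h : Laurent R n)
    (z : Frac h) (s : ℕ) : (cartier σ h (AdicCompletion.of _ _ z)).val s = cartierLevel σ h s z :=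
  rfl

theorem constHat_cartier [Fact p.Prime] (σ : FrobeniusLift p R) {h : Laurent R n}
    (hu : IsUnit (expandT A n h)) (hu' : IsUnit (expandT A n (twist σ h)))
    (y : Compl p R (Frac h)) :
    constHat p (twist σ h) hu' (cartier σ h y) = constHat p h hu y := by
  refine AdicCompletion.ext fun s => ?_
  obtain ⟨z, hz⟩ := Submodule.Quotient.mk_surjective _ (y.val s)
  obtain ⟨w, hw⟩ := Submodule.Quotient.mk_surjective _ ((cartier σ h y).val s)
  have H : cartierLevel σ h s z = Submodule.Quotient.mk w := by
    rw [hw, cartier_val, ← hz]; rfl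
  obtain ⟨v, hv⟩ := dvd_constFrac_sub σ hu hu' H
  have e1 : (constHat p h hu y).val s = Submodule.Quotient.mk (constFrac h hu z) := by
    rw [constHat, LinearMap.restrictScalars_apply, AdicCompletion.map_val_apply, ← hz]; rfl
  have e2 : (constHat p (twist σ h) hu' (cartier σ h y)).val s =
      Submodule.Quotient.mk (constFrac (twist σ h) hu' w) := by
    rw [constHat, LinearMap.restrictScalars_apply, AdicCompletion.map_val_apply, ← hw]; rfl
  refine e2.trans (Eq.trans ?_ e1.symm)
  rw [eq_comm, mk_eq_mk_iff_exists]
  exact ⟨v, by rw [hv, Algebra.smul_def, map_pow, map_natCast]⟩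

/-- Reducing to level s brings an equation in the completion back to a congruence in A⟦t⟧ itself,
without completeness of A⟦t⟧. -/
theorem dvd_of_of_eq {x y : PowerSeries A} (s : ℕ) {z : Compl p R (PowerSeries A)}
    (H : AdicCompletion.of (Ideal.span {(p : R)}) _ x - AdicCompletion.of _ _ y =
      (p : R) ^ s • z) :
    (p : PowerSeries A) ^ s ∣ x - y := by
  obtain ⟨w, hw⟩ := Submodule.Quotient.mk_surjective _ (z.val s)
  have h1 : (Submodule.Quotient.mk (x - y) : ModPow p R (PowerSeries A) s) =
      (p : R) ^ s • z.val s := congrArg (fun q => q.val s) H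
  rw [← hw, ← Submodule.Quotient.mk_smul, mk_eq_mk_iff_exists] at h1
  obtain ⟨v, hv⟩ := h1
  refine ⟨w + v, ?_⟩
  rw [sub_eq_iff_eq_add, ← smul_add, Algebra.smul_def, map_pow, map_natCast, add_comm v] at hv
  exact hv

end Expansion

/-! ### Divisibility, separatedness and units in the base ring. -/

section BaseRing

open Polynomial

variable {p : ℕ} [Fact p.Prime] {β : ℤ_[p][X]}

/-- By saturation, division by p inside ℤ_p⟦t⟧ does not leave the base ring; congruences between
constant terms thereby become congruences between coefficients. -/
theorem completedAlg_dvd_iff (hβ : β.coeff 0 = 1) (s : ℕ) (x : completedAlg β) :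
    (p : completedAlg β) ^ s ∣ x ↔ (p : PowerSeries ℤ_[p]) ^ s ∣ (x : PowerSeries ℤ_[p]) := by
  constructor
  · rintro ⟨y, rfl⟩
    exact ⟨y, by push_cast; rfl⟩
  · rintro ⟨y, hy⟩
    have : ∀ (s : ℕ) (e : PowerSeries ℤ_[p]), (p : PowerSeries ℤ_[p]) ^ s * e ∈ completedAlg β →
        e ∈ completedAlg β := by
      intro s
      induction s with
      | zero => intro e he; simpa using he
      | succ s ih =>
        intro e he
        rw [pow_succ, mul_assoc] at he
        exact saturated hβ (ih _ he)
    refine ⟨⟨y, this s y (hy ▸ x.2)⟩, Subtype.ext ?_⟩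
    push_cast
    exact hy

theorem eq_zero_of_forall_pow_dvd {x : PowerSeries ℤ_[p]}
    (h : ∀ s : ℕ, (p : PowerSeries ℤ_[p]) ^ s ∣ x) : x = 0 := by
  ext k
  rw [map_zero]
  refine IsHausdorff.haus (inferInstance :
    IsHausdorff (IsLocalRing.maximalIdeal ℤ_[p]) ℤ_[p]) _ fun s => ?_
  rw [SModEq.zero, smul_eq_mul, Ideal.mul_top, PadicInt.maximalIdeal_eq_span_p,
    Ideal.span_singleton_pow, Ideal.mem_span_singleton]
  obtain ⟨y, hy⟩ := h s
  refine ⟨PowerSeries.coeff k y, ?_⟩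
  rw [hy, ← Nat.cast_pow, ← nsmul_eq_mul, map_nsmul, nsmul_eq_mul, Nat.cast_pow]

theorem completedAlg_natCast_mul_eq_zero {r : completedAlg β} (h : (p : completedAlg β) * r = 0) :
    r = 0 := by
  have h1 := congrArg (Subtype.val) h
  push_cast at h1
  exact Subtype.ext ((mul_eq_zero.1 h1).resolve_left p_ne)

/-- `p` lies in the Jacobson radical of `completedAlg β`. -/
theorem completedAlg_isUnit_add {v : completedAlg β} (hv : IsUnit v) (z : completedAlg β) :
    IsUnit (v + p * z) := by
  obtain ⟨v', hv'⟩ := hv.exists_right_inv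
  have hV : (v : PowerSeries ℤ_[p]) * v' = 1 := congrArg Subtype.val hv'
  have hu : IsUnit ((v : PowerSeries ℤ_[p]) + p * z) := by
    rw [PowerSeries.isUnit_iff_constantCoeff, map_add, map_mul, map_natCast]
    have h1 : IsUnit (PowerSeries.constantCoeff (v : PowerSeries ℤ_[p])) :=
      (IsUnit.of_mul_eq_one _ hV).map _
    by_contra h2
    have h3 : (p : ℤ_[p]) * PowerSeries.constantCoeff (z : PowerSeries ℤ_[p]) ∈ nonunits ℤ_[p] :=
      fun h => PadicInt.p_nonunit (isUnit_of_mul_isUnit_left h)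
    have h4 := IsLocalRing.nonunits_add (show _ ∈ nonunits _ from h2)
      (show -(_ * _) ∈ nonunits ℤ_[p] from fun h => h3 ((IsUnit.neg_iff _).1 h))
    apply h4
    rwa [add_neg_cancel_right]
  obtain ⟨b, hb⟩ := hu.exists_right_inv
  have hmem : b ∈ completedAlg β := by
    apply mem_of_closed
    intro s
    -- The geometric series of 1/(v + pz), truncated, approximates the inverse taken in ℤ_p⟦t⟧
    -- modulo p^s by elements of the ring.
    refine ⟨v' * ∑ k ∈ Finset.range s, (-(p * (z : PowerSeries ℤ_[p]) * v')) ^ k, ?_, ?_⟩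
    · exact mul_mem v'.2 (sum_mem fun k _ => pow_mem (neg_mem
        (mul_mem (mul_mem (natCast_mem _ p) z.2) v'.2)) k)
    · have hg := geom_sum_mul_neg (-((p : PowerSeries ℤ_[p]) * z * v')) s
      set G := ∑ k ∈ Finset.range s, (-((p : PowerSeries ℤ_[p]) * z * v')) ^ k
      refine ⟨b * (-(z * v')) ^ s, ?_⟩
      have e : (p : PowerSeries ℤ_[p]) ^ s * (b * (-((z : PowerSeries ℤ_[p]) * v')) ^ s) =
          b * (-(p * z * v')) ^ s := by
        rw [show -((p : PowerSeries ℤ_[p]) * z * v') = p * -(z * v') by ring, mul_pow]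
        ring
      rw [e]
      linear_combination (-b) * hg + (v' * G) * hb - b * G * hV
  exact IsUnit.of_mul_eq_one ⟨b, hmem⟩ (Subtype.ext hb)

end BaseRing

/-! ### Coefficients and supports under change of coefficients. -/

section Twist

theorem coeff_twist {p n : ℕ} {R : Type*} [CommRing R] (σ : FrobeniusLift p R) (a : Laurent R n)
    (u : Fin n → ℤ) : (twist σ a).coeff u = σ.toRingHom (a.coeff u) := by
  simp [twist]

theorem suppIn_map {R S : Type*} {n : ℕ} [CommRing R] [CommRing S] (φ : R →+* S) {a : Laurent R n}
    {Δ : Set (Fin n → ℝ)} (ha : SuppIn a Δ) :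
    SuppIn (AddMonoidAlgebra.mapRingHom (Fin n → ℤ) φ a) Δ := by
  intro u hu
  apply ha u
  rw [Finsupp.mem_support_iff] at hu ⊢
  intro h
  apply hu
  simp [h]

end Twist

/-! ### The class of polynomials containing f and stable under σ. -/

section Admissible

variable {p : ℕ} [Fact p.Prime] {n : ℕ} {g : Laurent ℤ_[p] n}

/-- The Laurent polynomials over `BaseRing g` to which the unit-root argument applies. -/
structure Admissible (g : Laurent ℤ_[p] n) (h : Laurent (BaseRing g) n) : Prop where
  suppIn : SuppIn h (newtonPolytope g)
  constantCoeff_eq_one : PowerSeries.constantCoeff (expandT ℤ_[p] n h) = 1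
  isUnit_hasseWitt : IsUnit ((h ^ (p - 1)).coeff 0)

theorem expandT_twist (h : Laurent (BaseRing g) n) :
    expandT ℤ_[p] n (twist (sigma g) h) =
      PowerSeries.expand p (Fact.out : p.Prime).ne_zero (expandT ℤ_[p] n h) := by
  ext k u
  rw [coeff_expandT, coeff_twist]
  change PowerSeries.coeff k (PowerSeries.expand p (Fact.out : p.Prime).ne_zero (h.coeff u : PowerSeries ℤ_[p])) = _
  rw [PowerSeries.coeff_expand, PowerSeries.coeff_expand]
  split_ifs
  · rw [coeff_expandT]; rfl
  · rfl

/-- Each application of the Cartier operator replaces h by h^σ, so all inductions run over a class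
stable under σ. -/
theorem Admissible.twist {h : Laurent (BaseRing g) n} (H : Admissible g h) :
    Admissible g (twist (sigma g) h) where
  suppIn := H.suppIn.twist
  constantCoeff_eq_one := by
    rw [expandT_twist, PowerSeries.constantCoeff_expand, H.constantCoeff_eq_one]
  isUnit_hasseWitt := by
    rw [← map_pow, coeff_twist]
    exact H.isUnit_hasseWitt.map _

theorem Admissible.isUnit {h : Laurent (BaseRing g) n} (H : Admissible g h) :
    IsUnit (expandT ℤ_[p] n h) := by
  rw [PowerSeries.isUnit_iff_constantCoeff, H.constantCoeff_eq_one]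
  exact isUnit_one

theorem expandT_fPoly (g : Laurent ℤ_[p] n) :
    expandT ℤ_[p] n (fPoly g) = 1 - PowerSeries.X * PowerSeries.C g := by
  have h1 : expandT ℤ_[p] n
      (AddMonoidAlgebra.mapRingHom (Fin n → ℤ) (algebraMap ℤ_[p] (BaseRing g)) g) =
      PowerSeries.C g := by
    ext k u
    rw [coeff_expandT, AddMonoidAlgebra.coeff_mapRingHom]
    change PowerSeries.coeff k (PowerSeries.C (g.coeff u)) = _
    rw [PowerSeries.coeff_C, PowerSeries.coeff_C]
    split_ifs <;> simp
  have h2 : expandT ℤ_[p] n (AddMonoidAlgebra.single 0 (tElt g)) = PowerSeries.X := by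
    rw [expandT_single]
    change PowerSeries.map _ PowerSeries.X * _ = _
    rw [PowerSeries.map_X, ← AddMonoidAlgebra.one_def, map_one, mul_one]
  have h3 : ∀ a : Laurent (BaseRing g) n, tElt g • a = AddMonoidAlgebra.single 0 (tElt g) * a := by
    intro a
    rw [Algebra.smul_def, AddMonoidAlgebra.coe_algebraMap]
    rfl
  rw [fPoly, pencil, map_sub, map_one, h3, map_mul, h1, h2]

theorem mapRingHom_pencil {S T : Type*} [CommRing S] [CommRing T] [Algebra ℤ_[p] S]
    [Algebra ℤ_[p] T] (φ : S →ₐ[ℤ_[p]] T) (t : S) (g : Laurent ℤ_[p] n) :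
    AddMonoidAlgebra.mapRingHom (Fin n → ℤ) (φ : S →+* T) (pencil t g) = pencil (φ t) g := by
  rw [pencil, pencil, map_sub, map_one]
  congr 1
  ext u
  simp

/-- The pencil over ℤ_p[t] and the one over the base ring have the same image over ℤ_p⟦t⟧, where
their Hasse–Witt entries can be compared. -/
theorem coe_coeff_fPoly_pow (g : Laurent ℤ_[p] n) :
    (((fPoly g ^ (p - 1)).coeff 0 : BaseRing g) : PowerSeries ℤ_[p]) = beta g := by
  have h1 := mapRingHom_pencil (completedAlg (beta g)).val (tElt g) g
  have h2 := mapRingHom_pencil (Polynomial.coeToPowerSeries.algHom (R := ℤ_[p]) ℤ_[p])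
    Polynomial.X g
  have h3 : (Polynomial.coeToPowerSeries.algHom (R := ℤ_[p]) ℤ_[p]) Polynomial.X =
      (completedAlg (beta g)).val (tElt g) := by
    rw [Polynomial.coeToPowerSeries.algHom_apply, Polynomial.coe_X, Algebra.algebraMap_self,
      PowerSeries.map_id]
    rfl
  rw [h3, ← h1] at h2
  have h4 := congrArg (fun a : Laurent (PowerSeries ℤ_[p]) n => (a ^ (p - 1)).coeff 0) h2
  simp only [← map_pow, AddMonoidAlgebra.coeff_mapRingHom] at h4
  have h5 : beta g = (pencil Polynomial.X g ^ (p - 1)).coeff 0 := by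
    rw [beta, hasseWitt, smul_zero, sub_zero]
  refine h4.symm.trans (Eq.trans ?_ (congrArg _ h5.symm))
  change Polynomial.coeToPowerSeries.algHom (R := ℤ_[p]) ℤ_[p] _ = _
  rw [Polynomial.coeToPowerSeries.algHom_apply, Algebra.algebraMap_self, PowerSeries.map_id]
  rfl

theorem admissible_fPoly (h0 : (0 : Fin n → ℝ) ∈ newtonPolytope g) : Admissible g (fPoly g) where
  suppIn := by
    rw [fPoly, pencil, sub_eq_add_neg]
    refine (suppIn_one h0).add (SuppIn.neg ?_)
    have h1 : SuppIn g (newtonPolytope g) :=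
      fun u hu => subset_convexHull ℝ _ (Set.mem_image_of_mem _ hu)
    intro u hu
    apply suppIn_map (algebraMap ℤ_[p] (BaseRing g)) h1 u
    rw [Finsupp.mem_support_iff] at hu ⊢
    intro h
    apply hu
    rw [AddMonoidAlgebra.coeff_smul, Finsupp.smul_apply, h, smul_zero]
  constantCoeff_eq_one := by
    rw [expandT_fPoly]
    simp
  isUnit_hasseWitt := by
    -- The Hasse–Witt entry is β_p, whose inverse was adjoined in the construction of the base ring.
    refine IsUnit.of_mul_eq_one ⟨_, fracAlg_le _ (inv_mem (beta g))⟩ (Subtype.ext ?_)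
    rw [MulMemClass.coe_mul, coe_coeff_fPoly_pow]
    exact beta_mul_inv (beta_coeff_zero g)

end Admissible

/-! ### Supports in the Cartier expansion; the single interior lattice point. -/

section Polytope

variable {p : ℕ} [Fact p.Prime] {n : ℕ} {g : Laurent ℤ_[p] n}

theorem convex_newtonPolytope (g : Laurent ℤ_[p] n) : Convex ℝ (newtonPolytope g) :=
  convex_convexHull ℝ _

/-- The rational function `1/h`. -/
def oneDiv {R : Type*} [CommRing R] (h : Laurent R n) : Frac h :=
  frac h (AddMonoidAlgebra.single 0 1) 1

theorem Admissible.exists_frobenius_sub {h : Laurent (BaseRing g) n} (H : Admissible g h)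
    (h0 : (0 : Fin n → ℝ) ∈ newtonPolytope g) :
    ∃ G, inflate p _ n (DworkCrystal.twist (sigma g) h) = h ^ p + p * G ∧
      SuppIn G ((p : ℝ) • newtonPolytope g) := by
  obtain ⟨G, hG⟩ := dvd_inflate_twist_sub (sigma g) h
  refine ⟨G, by rw [← hG]; ring, ?_⟩
  apply SuppIn.of_natCast_mul (p := p) (fun r hr => completedAlg_natCast_mul_eq_zero hr)
  rw [← hG, sub_eq_add_neg]
  exact H.twist.suppIn.inflate.add (H.suppIn.pow (convex_newtonPolytope g) h0 p).neg

/-- The product is supported in (k + (p(m+1) - k) + pr)Δ° = p(m+1+r)Δ°, and decimation divides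
exponents by p. -/
theorem SuppIn.decimate_mul_pow {R : Type*} [CommRing R] {Δ : Set (Fin n → ℝ)}
    (hΔ : Convex ℝ Δ) (h0 : (0 : Fin n → ℝ) ∈ Δ) {a h G : Laurent R n} (hh : SuppIn h Δ)
    (hG : SuppIn G ((p : ℝ) • Δ)) {k m : ℕ} (hk1 : 1 ≤ k)
    (hk : k ≤ p * (m + 1)) (ha : SuppIn a ((k : ℝ) • interior Δ)) (r : ℕ) :
    SuppIn (DworkCrystal.decimate p R n (a * h ^ (p * (m + 1) - k) * G ^ r))
      (((m + 1 + r : ℕ) : ℝ) • interior Δ) := by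
  apply SuppIn.decimate
  have h1 := ha.mul_interior hΔ hk1 (hh.pow hΔ h0 (p * (m + 1) - k))
  have h2 := hG.pow (hΔ.smul (p : ℝ)) ⟨0, h0, smul_zero _⟩ r
  rw [smul_smul, ← Nat.cast_mul] at h2
  have h3 := h1.mul_interior hΔ (by omega) h2
  have e : k + (p * (m + 1) - k) + r * p = p * (m + 1 + r) := by
    rw [Nat.add_sub_cancel' hk]; ring
  rwa [e] at h3

/-- This is where the uniqueness of the interior lattice point enters: it makes the pole-order-one
part of Ω free on 1/h, hence the crystal of rank one. -/
theorem frac_eq_smul_oneDiv {Δ : Set (Fin n → ℝ)}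
    (hg : ∀ u : Fin n → ℤ, toReal u ∈ interior Δ ↔ u = 0)
    {R : Type*} [CommRing R] (h a : Laurent R n)
    (ha : SuppIn a (((0 + 1 : ℕ) : ℝ) • interior Δ)) :
    frac h a 1 = a.coeff 0 • oneDiv h := by
  have h1 : a = a.coeff 0 • AddMonoidAlgebra.single 0 1 := by
    ext u
    by_cases hu : u = 0
    · simp [hu]
    · have h2 : a.coeff u = 0 := by
        by_contra h3
        have := ha u (Finsupp.mem_support_iff.2 h3)
        rw [zero_add, Nat.cast_one, one_smul, hg] at this
        exact hu this
      rw [h2]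
      simp [hu]
  rw [oneDiv, ← fracLin_apply, ← fracLin_apply, ← map_smul, ← h1]

theorem suppIn_single_zero {Δ : Set (Fin n → ℝ)}
    (hg : ∀ u : Fin n → ℤ, toReal u ∈ interior Δ ↔ u = 0) {R : Type*} [CommRing R] :
    SuppIn (AddMonoidAlgebra.single 0 1 : Laurent R n) (((1 : ℕ) : ℝ) • interior Δ) := by
  rw [← AddMonoidAlgebra.one_def]
  apply suppIn_one
  rw [Nat.cast_one, one_smul, ← toReal_zero, hg]

end Polytope

/-! ### Congruences for constant terms and the ratio q(t)/q(t^p). -/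

section ConstantTerms

variable {p : ℕ} [Fact p.Prime] {n : ℕ} {g : Laurent ℤ_[p] n}

/-- The constant term of the expansion of a rational function with denominator `h`. -/
def Admissible.const {h : Laurent (BaseRing g) n} (H : Admissible g h) :
    Frac h →ₗ[BaseRing g] PowerSeries ℤ_[p] := constFrac h H.isUnit

theorem Admissible.const_apply {h : Laurent (BaseRing g) n} (H : Admissible g h) (z : Frac h) :
    H.const z = constTerm (expandFrac h H.isUnit z) := rfl

/-- The module generated by the `a/h^k`, `k ≥ 1`, with `a` supported in `k` times the interior of
the Newton polytope. -/
def OmegaFull (g : Laurent ℤ_[p] n) (h : Laurent (BaseRing g) n) :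
    Submodule (BaseRing g) (Frac h) :=
  Submodule.span _ {ω | ∃ (k : ℕ) (a : Laurent (BaseRing g) n), 1 ≤ k ∧
    SuppIn a ((k : ℝ) • interior (newtonPolytope g)) ∧ ω = frac h a k}

/-- Take constant terms in the Cartier expansion. All terms with r ≥ 1 carry a factor p, and what
remains lies in a module without factorials, so no lower bound on p^r/r! is needed and p = 2 is
allowed. -/
theorem Admissible.const_frac
    (h0 : (0 : Fin n → ℝ) ∈ newtonPolytope g)
    {h : Laurent (BaseRing g) n} (H : Admissible g h) {k m : ℕ} {a : Laurent (BaseRing g) n}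
    (hk1 : 1 ≤ k) (hk : k ≤ p * (m + 1))
    (ha : SuppIn a ((k : ℝ) • interior (newtonPolytope g))) (s : ℕ) :
    ∃ η ∈ OmegaFull g (DworkCrystal.twist (sigma g) h), (p : PowerSeries ℤ_[p]) ^ s ∣
      H.const (frac h a k) - H.twist.const (frac _
        (decimate p _ n (a * h ^ (p * (m + 1) - k))) (m + 1)) - p * H.twist.const η := by
  obtain ⟨G, hG, hGs⟩ := H.exists_frobenius_sub h0
  obtain _ | s := s
  · exact ⟨0, zero_mem _, by simp⟩
  have h1 := dvd_constFrac_sub (sigma g) H.isUnit H.twist.isUnit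
    (cartierLevel_frac (sigma g) h a G hG hk (s + 1))
  set c : ℕ → Frac (DworkCrystal.twist (sigma g) h) := fun r => frac _ (decimate p _ n
    (a * h ^ (p * (m + 1) - k) * G ^ r)) (m + 1 + r) with hc
  have h0' : c 0 = frac _ (decimate p _ n (a * h ^ (p * (m + 1) - k))) (m + 1) := by
    simp only [hc, pow_zero, mul_one, add_zero]
  set η := ∑ r ∈ Finset.range s, (((m + (r + 1)).choose m * p ^ r : ℕ) : BaseRing g) • c (r + 1)
    with hη
  have h2 : ∑ r ∈ Finset.range (s + 1), (((m + r).choose m * p ^ r : ℕ) : BaseRing g) • c r =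
      c 0 + (p : BaseRing g) • η := by
    rw [Finset.sum_range_succ', add_comm, hη, Finset.smul_sum]
    congr 1
    · simp
    · refine Finset.sum_congr rfl fun r _ => ?_
      rw [smul_smul]
      congr 1
      push_cast
      ring
  refine ⟨η, ?_, ?_⟩
  · refine sum_mem fun r _ => Submodule.smul_mem _ _ (Submodule.subset_span
      ⟨m + 1 + (r + 1), decimate p _ n (a * h ^ (p * (m + 1) - k) * G ^ (r + 1)), by omega, ?_, rfl⟩)
    exact SuppIn.decimate_mul_pow (convex_newtonPolytope g) h0 H.suppIn hGs hk1 hk ha _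
  · rw [h2, map_add, map_smul, h0', ← sub_sub, Subalgebra.smul_def, smul_eq_mul] at h1
    exact_mod_cast h1

theorem Admissible.const_oneDiv
    (hg : ∀ u : Fin n → ℤ, toReal u ∈ interior (newtonPolytope g) ↔ u = 0)
    (h0 : (0 : Fin n → ℝ) ∈ newtonPolytope g)
    {h : Laurent (BaseRing g) n} (H : Admissible g h) (s : ℕ) :
    ∃ η ∈ OmegaFull g (DworkCrystal.twist (sigma g) h), (p : PowerSeries ℤ_[p]) ^ s ∣
      H.const (oneDiv h) - (h ^ (p - 1)).coeff 0 • H.twist.const (oneDiv _) -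
        p * H.twist.const η := by
  have hk : 1 ≤ p * (0 + 1) := by simpa using (Fact.out : p.Prime).one_le
  obtain ⟨η, hη, h1⟩ := H.const_frac h0 le_rfl hk (suppIn_single_zero hg) s
  refine ⟨η, hη, ?_⟩
  -- Only the support of the r = 0 term is wanted, where G plays no role; G = 0 serves.
  have h2 : SuppIn (0 : Laurent (BaseRing g) n) ((p : ℝ) • newtonPolytope g) := by
    intro u hu; simp at hu
  have h3 := SuppIn.decimate_mul_pow (convex_newtonPolytope g) h0 H.suppIn h2 le_rfl hk
    (suppIn_single_zero (R := BaseRing g) hg) 0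
  rw [pow_zero, mul_one] at h3
  have h4 : frac (DworkCrystal.twist (sigma g) h) (decimate p _ n
      (AddMonoidAlgebra.single 0 1 * h ^ (p * (0 + 1) - 1))) (0 + 1) =
      (h ^ (p - 1)).coeff 0 • oneDiv _ := by
    refine (frac_eq_smul_oneDiv hg _ _ h3).trans ?_
    rw [decimate_coeff, smul_zero, ← AddMonoidAlgebra.one_def, one_mul, zero_add, mul_one]
  rw [h4, map_smul] at h1
  exact h1

/-- Every constant term is, modulo `p^s`, a multiple of the constant term of `1/h`; and the ratio of
those of `1/h` and `1/h^σ` is a unit. -/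
theorem const_mod_pow (hg : ∀ u : Fin n → ℤ, toReal u ∈ interior (newtonPolytope g) ↔ u = 0)
    (h0 : (0 : Fin n → ℝ) ∈ newtonPolytope g) (s : ℕ) :
    (∀ (h : Laurent (BaseRing g) n) (H : Admissible g h), ∃ v : BaseRing g, IsUnit v ∧
      (p : PowerSeries ℤ_[p]) ^ s ∣ H.const (oneDiv h) - v • H.twist.const (oneDiv _)) ∧
    ∀ (h : Laurent (BaseRing g) n) (H : Admissible g h), ∀ ω ∈ OmegaFull g h, ∃ l : BaseRing g,
      (p : PowerSeries ℤ_[p]) ^ s ∣ H.const ω - l • H.const (oneDiv h) := by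
  induction s with
  | zero => exact ⟨fun h H => ⟨1, isUnit_one, by simp⟩, fun h H ω _ => ⟨0, by simp⟩⟩
  | succ s ih =>
    -- The error term is p times a constant term known modulo p^s, which gains one power of p; v =
    -- (Hasse–Witt entry) + pl is still a unit.
    have hA : ∀ (h : Laurent (BaseRing g) n) (H : Admissible g h), ∃ v : BaseRing g, IsUnit v ∧
        (p : PowerSeries ℤ_[p]) ^ (s + 1) ∣
          H.const (oneDiv h) - v • H.twist.const (oneDiv _) := by
      intro h H
      obtain ⟨η, hη, h1⟩ := H.const_oneDiv hg h0 (s + 1)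
      obtain ⟨l, hl⟩ := ih.2 _ H.twist η hη
      refine ⟨(h ^ (p - 1)).coeff 0 + p * l, completedAlg_isUnit_add H.isUnit_hasseWitt l, ?_⟩
      have h2 := mul_dvd_mul_left (p : PowerSeries ℤ_[p]) hl
      rw [← pow_succ'] at h2
      convert dvd_add h1 h2 using 1
      simp only [Subalgebra.smul_def, smul_eq_mul]
      push_cast
      ring
    -- Strong induction on the pole order, for all admissible h at once: the Cartier operator lowers
    -- the order k ≥ 2 but replaces h by h^σ. The unit v of `hA` leads back from 1/h^σ to 1/h.
    have key : ∀ (k : ℕ) (h : Laurent (BaseRing g) n) (H : Admissible g h) (a : Laurent (BaseRing g) n),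
        1 ≤ k → SuppIn a ((k : ℝ) • interior (newtonPolytope g)) → ∃ l : BaseRing g,
          (p : PowerSeries ℤ_[p]) ^ (s + 1) ∣ H.const (frac h a k) - l • H.const (oneDiv h) := by
      intro k
      induction k using Nat.strong_induction_on with
      | _ k IH =>
      intro h H a hk ha
      obtain rfl | hk2 := Nat.eq_or_lt_of_le hk
      · exact ⟨a.coeff 0, by rw [frac_eq_smul_oneDiv hg _ _ ha, map_smul, sub_self]; exact dvd_zero _⟩
      · have hp2 := (Fact.out : p.Prime).two_le
        obtain ⟨m, hm1, hm2⟩ : ∃ m, k ≤ p * (m + 1) ∧ m + 1 < k := by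
          -- The new pole order is k - 1, and k ≤ p(k - 1) because k ≥ 2 and p ≥ 2.
          refine ⟨k - 2, ?_, by omega⟩
          calc k ≤ 2 * (k - 2 + 1) := by omega
            _ ≤ _ := Nat.mul_le_mul_right _ hp2
        obtain ⟨η, hη, h1⟩ := H.const_frac h0 hk hm1 ha (s + 1)
        have h2 : SuppIn (0 : Laurent (BaseRing g) n) ((p : ℝ) • newtonPolytope g) := by
          intro u hu; simp at hu
        have h3 := SuppIn.decimate_mul_pow (convex_newtonPolytope g) h0 H.suppIn h2 hk hm1 ha 0
        rw [pow_zero, mul_one, add_zero] at h3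
        obtain ⟨l, hl⟩ := IH (m + 1) hm2 _ H.twist _ (by omega) h3
        obtain ⟨l', hl'⟩ := ih.2 _ H.twist η hη
        obtain ⟨v, hv, h4⟩ := hA h H
        obtain ⟨v', hv'⟩ := hv.exists_right_inv
        have hV : (v : PowerSeries ℤ_[p]) * v' = 1 := congrArg Subtype.val hv'
        refine ⟨(l + p * l') * v', ?_⟩
        have h5 := mul_dvd_mul_left (p : PowerSeries ℤ_[p]) hl'
        rw [← pow_succ'] at h5
        simp only [Subalgebra.smul_def, smul_eq_mul] at h1 hl h4 h5 ⊢
        obtain ⟨w1, h1⟩ := h1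
        obtain ⟨w2, h2⟩ := hl
        obtain ⟨w3, h3⟩ := h4
        obtain ⟨w4, h4⟩ := h5
        refine ⟨w1 + w2 + w4 - (l + p * l') * v' * w3, ?_⟩
        push_cast
        linear_combination h1 + h2 + h4 - ((l : PowerSeries ℤ_[p]) + p * l') * v' * h3 -
          ((l : PowerSeries ℤ_[p]) + p * l') * H.twist.const (oneDiv _) * hV
    refine ⟨hA, fun h H ω hω => ?_⟩
    induction hω using Submodule.span_induction with
    | zero => exact ⟨0, by simp⟩
    | add x y _ _ hx hy =>
      obtain ⟨l, hl⟩ := hx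
      obtain ⟨l', hl'⟩ := hy
      refine ⟨l + l', ?_⟩
      convert dvd_add hl hl' using 1
      rw [map_add, add_smul]
      ring
    | smul r x _ hx =>
      obtain ⟨l, hl⟩ := hx
      refine ⟨r * l, ?_⟩
      rw [map_smul, mul_smul, ← smul_sub, Subalgebra.smul_def]
      exact dvd_mul_of_dvd_right hl _
    | mem x hx =>
      obtain ⟨k, a, hk, ha, rfl⟩ := hx
      exact key k h H a hk ha

theorem expandFrac_oneDiv_mul (h : Laurent (BaseRing g) n) (hu : IsUnit (expandT ℤ_[p] n h)) :
    expandFrac h hu (oneDiv h) * expandT ℤ_[p] n h = 1 := by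
  have h1 := expandFrac_mk_mul h hu (AddMonoidAlgebra.single 0 1) ⟨h ^ 1, 1, rfl⟩
  rw [← AddMonoidAlgebra.one_def, map_one] at h1
  have h2 : expandFrac h hu (oneDiv h) * expandT ℤ_[p] n (h ^ 1) = 1 := h1
  rwa [pow_one] at h2

theorem const_oneDiv_fPoly (H : Admissible g (fPoly g)) : H.const (oneDiv (fPoly g)) = qSeries g := by
  have h1 := expandFrac_oneDiv_mul (fPoly g) H.isUnit
  -- The geometric series of 1/(1 - tg).
  have h2 : PowerSeries.mk (fun k => g ^ k) * expandT ℤ_[p] n (fPoly g) = 1 := by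
    rw [expandT_fPoly, mul_sub, mul_one, ← mul_assoc, mul_comm _ PowerSeries.X]
    ext1 k
    obtain _ | k := k
    · simp
    · rw [map_sub, mul_assoc, PowerSeries.coeff_succ_X_mul, PowerSeries.coeff_mul_C,
        PowerSeries.coeff_mk, PowerSeries.coeff_mk, pow_succ, sub_self, PowerSeries.coeff_one,
        if_neg k.succ_ne_zero]
  have h3 := H.isUnit.mul_right_cancel (h1.trans h2.symm)
  rw [Admissible.const_apply, h3]
  ext k
  rw [coeff_constTerm, PowerSeries.coeff_mk, qSeries, PowerSeries.coeff_mk]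

theorem const_oneDiv_twist {h : Laurent (BaseRing g) n} (H : Admissible g h) :
    H.twist.const (oneDiv _) = substPow p (H.const (oneDiv h)) := by
  have h1 := expandFrac_oneDiv_mul h H.isUnit
  have h2 := expandFrac_oneDiv_mul _ H.twist.isUnit
  have h3 := congrArg (PowerSeries.expand p (Fact.out : p.Prime).ne_zero) h1
  rw [map_mul, ← expandT_twist, map_one] at h3
  have h4 := H.twist.isUnit.mul_right_cancel (h2.trans h3.symm)
  rw [Admissible.const_apply, Admissible.const_apply, h4]
  ext k
  rw [coeff_constTerm, substPow, PowerSeries.coeff_expand, PowerSeries.coeff_expand]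
  split_ifs
  · rw [coeff_constTerm]
  · rfl

theorem isUnit_qSeries (g : Laurent ℤ_[p] n) : IsUnit (qSeries g) := by
  rw [PowerSeries.isUnit_iff_constantCoeff, ← PowerSeries.coeff_zero_eq_constantCoeff_apply, qSeries,
    PowerSeries.coeff_mk, pow_zero]
  simp

/-- The ratio `q(t)/q(t^p)` lies in the base ring. -/
theorem exists_ratio (hg : ∀ u : Fin n → ℤ, toReal u ∈ interior (newtonPolytope g) ↔ u = 0)
    (h0 : (0 : Fin n → ℝ) ∈ newtonPolytope g) :
    ∃ l : BaseRing g, (l : PowerSeries ℤ_[p]) * substPow p (qSeries g) = qSeries g := by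
  obtain ⟨b, hb⟩ := ((isUnit_qSeries g).map (substPow p)).exists_right_inv
  have H := admissible_fPoly h0
  refine ⟨⟨qSeries g * b, mem_of_closed fun s => ?_⟩, ?_⟩
  · obtain ⟨v, -, hv⟩ := (const_mod_pow hg h0 s).1 _ H
    rw [const_oneDiv_twist H, const_oneDiv_fPoly H, Subalgebra.smul_def, smul_eq_mul] at hv
    refine ⟨v, v.2, ?_⟩
    convert hv.mul_right b using 1
    linear_combination (v : PowerSeries ℤ_[p]) * hb
  · change qSeries g * b * _ = _
    linear_combination qSeries g * hb

end ConstantTerms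

/-! ### Series in the completed modules. -/

section Completed

variable {p : ℕ} {R : Type*} [CommRing R] {M : Type*} [AddCommGroup M] [Module R M]

/-- The sum of the series `∑ p^j ω_j` in the completion. -/
theorem exists_compl_sum (ω : ℕ → M) : ∃ z : Compl p R M, ∀ s,
    z.val s = Submodule.Quotient.mk (∑ j ∈ Finset.range s, (p : R) ^ j • ω j) := by
  refine ⟨AdicCompletion.mk _ _ (AdicCompletion.AdicCauchySequence.mk _ _
    (fun s => ∑ j ∈ Finset.range s, (p : R) ^ j • ω j) fun s => ?_), fun s => rfl⟩
  rw [Finset.sum_range_succ, SModEq.comm, SModEq.sub_mem, add_sub_cancel_left,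
    mem_span_pow_smul_top]
  exact ⟨_, rfl⟩

theorem compl_exists_eq_of_add (z : Compl p R M) :
    ∃ (m : M) (z' : Compl p R M), z = AdicCompletion.of _ _ m + (p : R) • z' := by
  obtain ⟨m, hm⟩ := Submodule.Quotient.mk_surjective _ (z.val 1)
  have h : z - AdicCompletion.of _ _ m ∈ LinearMap.ker (AdicCompletion.eval
      (Ideal.span {(p : R)}) M 1) := by
    rw [LinearMap.mem_ker, map_sub, sub_eq_zero]
    exact hm.symm
  rw [← AdicCompletion.pow_smul_top_eq_ker_eval (Submodule.fg_span_singleton _)] at h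
  obtain ⟨z', hz⟩ := (mem_span_pow_smul_top (p := p) (R := R) 1 _).1 h
  refine ⟨m, z', ?_⟩
  rw [pow_one] at hz
  rw [← hz, add_sub_cancel]

variable {n : ℕ} {f : Laurent R n} {μ : Set (Fin n → ℝ)}

theorem of_mem_omegaHat {ω : Frac f} (hω : ω ∈ Omega f μ) :
    AdicCompletion.of _ _ ω ∈ OmegaHat p f μ :=
  ⟨AdicCompletion.of _ _ ⟨ω, hω⟩, AdicCompletion.map_of _ _ _⟩

/-- `OmegaHat` is the image of a completion, so the series is summed in the completion of Ω and then
mapped. -/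
theorem exists_omegaHat_sum (ω : ℕ → Frac f) (hω : ∀ j, ω j ∈ Omega f μ) :
    ∃ z ∈ OmegaHat p f μ, ∀ s,
      z.val s = Submodule.Quotient.mk (∑ j ∈ Finset.range s, (p : R) ^ j • ω j) := by
  obtain ⟨z, hz⟩ := exists_compl_sum (p := p) (R := R) (fun j => (⟨ω j, hω j⟩ : Omega f μ))
  refine ⟨_, ⟨z, rfl⟩, fun s => ?_⟩
  rw [LinearMap.restrictScalars_apply, AdicCompletion.map_val_apply, hz]
  refine congrArg Submodule.Quotient.mk ?_
  simp

theorem exists_of_add_of_mem_omegaHat {y : Compl p R (Frac f)} (hy : y ∈ OmegaHat p f μ) :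
    ∃ ω ∈ Omega f μ, ∃ y' ∈ OmegaHat p f μ, y = AdicCompletion.of _ _ ω + (p : R) • y' := by
  obtain ⟨z, rfl⟩ := hy
  obtain ⟨m, z', rfl⟩ := compl_exists_eq_of_add z
  refine ⟨m, m.2, _, ⟨z', rfl⟩, ?_⟩
  rw [map_add, map_smul]
  congr 1

/-- A set of elements that can be expanded indefinitely lies in the completed module. -/
theorem subset_omegaHat {S : Set (Compl p R (Frac f))} (hS : ∀ y ∈ S, ∃ ω ∈ Omega f μ, ∃ y' ∈ S,
    y = AdicCompletion.of _ _ ω + (p : R) • y') {y : Compl p R (Frac f)} (hy : y ∈ S) :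
    y ∈ OmegaHat p f μ := by
  choose! w hw nx hnx heq using hS
  have hmem : ∀ s, nx^[s] y ∈ S := by
    intro s
    induction s with
    | zero => exact hy
    | succ s ih => rw [Function.iterate_succ_apply']; exact hnx _ ih
  obtain ⟨z, hz, hzs⟩ := exists_omegaHat_sum (p := p) (fun j => w (nx^[j] y))
    (fun j => hw _ (hmem j))
  suffices h : y = z by rwa [h]
  have h1 : ∀ s, y = AdicCompletion.of _ _ (∑ j ∈ Finset.range s, (p : R) ^ j • w (nx^[j] y)) +
      (p : R) ^ s • nx^[s] y := by
    intro s
    induction s with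
    | zero => simp
    | succ s ih =>
      rw [Finset.sum_range_succ, map_add, map_smul, Function.iterate_succ_apply', pow_succ,
        mul_smul, add_assoc, ← smul_add, ← heq _ (hmem s)]
      exact ih
  refine AdicCompletion.ext fun s => ?_
  obtain ⟨v, hv⟩ := Submodule.Quotient.mk_surjective _ ((nx^[s] y).val s)
  rw [hzs s]
  refine (congrArg (fun q => AdicCompletion.eval _ _ s q) (h1 s)).trans ?_
  rw [AdicCompletion.eval_apply, AdicCompletion.val_add_apply, AdicCompletion.val_smul_apply, ← hv]
  refine (Submodule.Quotient.eq _).2 ?_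
  rw [mem_span_pow_smul_top]
  exact ⟨v, add_sub_cancel_left _ _⟩

end Completed

/-! ### Divided powers of p and factorials. -/

section Factorials

variable {p : ℕ} [Fact p.Prime]

/-- For odd `p` the divided power `p^r / r!` is divisible by `p^{⌈r/2⌉}`. -/
theorem exists_pow_eq_mul_factorial (hp : p ≠ 2) (r : ℕ) :
    ∃ c : ℤ_[p], (p : ℤ_[p]) ^ r = p ^ ((r + 1) / 2) * c * (r.factorial : ℤ_[p]) := by
  have hp2 := (Fact.out : p.Prime).two_le
  have h1 := sub_one_mul_padicValNat_factorial (p := p) r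
  set v := padicValNat p r.factorial with hv
  -- Legendre's formula gives (p - 1)v ≤ r; this is where p ≥ 3 is needed.
  have h2 : 2 * v ≤ r := by
    calc 2 * v ≤ (p - 1) * v := Nat.mul_le_mul_right _ (by omega)
      _ ≤ r := by omega
  obtain ⟨m, hm⟩ : p ^ v ∣ r.factorial := pow_padicValNat_dvd
  have hm' : ¬ p ∣ m := by
    rintro ⟨k, rfl⟩
    have : p ^ (v + 1) ∣ r.factorial := ⟨k, by rw [hm]; ring⟩
    exact pow_succ_padicValNat_not_dvd r.factorial_ne_zero this
  have hu : IsUnit (m : ℤ_[p]) := by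
    rw [PadicInt.isUnit_iff, PadicInt.norm_natCast_eq_one_iff]
    exact ((Fact.out : p.Prime).coprime_iff_not_dvd.2 hm')
  obtain ⟨m', hm''⟩ := hu.exists_right_inv
  -- With r! = p^v m and m' the inverse of m, the exponent is a true difference, as v ≤ ⌊r/2⌋.
  refine ⟨p ^ (r - (r + 1) / 2 - v) * m', ?_⟩
  have e : r = (r + 1) / 2 + (r - (r + 1) / 2 - v) + v := by omega
  conv_lhs => rw [e]
  rw [hm]
  push_cast
  rw [pow_add, pow_add]
  linear_combination (-(p : ℤ_[p]) ^ ((r + 1) / 2) * p ^ (r - (r + 1) / 2 - v) * p ^ v) * hm''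

/-- In (pm)! the last factor supplies p and (pm - 1)! supplies m!. It makes the leading Cartier term
of a generator of high pole order divisible by p. -/
theorem mul_factorial_dvd {m k : ℕ} (hm : 1 ≤ m) (hk : p * m ≤ k) :
    p * m.factorial ∣ k.factorial := by
  have hp := (Fact.out : p.Prime).two_le
  have h1 : m < p * m := by nlinarith
  refine dvd_trans ?_ (Nat.factorial_dvd_factorial hk)
  obtain ⟨N, hN⟩ := Nat.exists_eq_succ_of_ne_zero (by omega : p * m ≠ 0)
  rw [hN, Nat.factorial_succ]
  refine mul_dvd_mul ⟨m, hN.symm⟩ (Nat.factorial_dvd_factorial (by omega))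

end Factorials

/-! ### The Cartier operator on the generators of Ω. -/

section CartierOmega

variable {p : ℕ} [Fact p.Prime] {n : ℕ}

theorem frac_mem_omega {R : Type*} [CommRing R] {h a : Laurent R n} {μ : Set (Fin n → ℝ)} {k : ℕ}
    (ha : SuppIn a (((k + 1 : ℕ) : ℝ) • μ)) :
    (k.factorial : R) • frac h a (k + 1) ∈ Omega h μ := by
  refine Submodule.subset_span ⟨k + 1, a, by omega, ha, ?_⟩
  rw [Nat.add_sub_cancel, Nat.cast_smul_eq_nsmul]

/-- The Cartier operator on a generator of `Ω_h`. -/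
theorem cartier_generator {R : Type*} [CommRing R] (σ : FrobeniusLift p R)
    (hfac : ∀ r : ℕ, ∃ c : R, (p : R) ^ r = p ^ ((r + 1) / 2) * c * (r.factorial : R))
    {Δ : Set (Fin n → ℝ)} (hΔ : Convex ℝ Δ) (h0 : (0 : Fin n → ℝ) ∈ Δ)
    {h G : Laurent R n} (hh : SuppIn h Δ)
    (hG : inflate p _ n (twist σ h) = h ^ p + p * G) (hGs : SuppIn G ((p : ℝ) • Δ))
    {k m K : ℕ} {a : Laurent R n} (hk : k + 1 ≤ p * (m + 1)) (hK : k.factorial = K * m.factorial)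
    (ha : SuppIn a (((k + 1 : ℕ) : ℝ) • interior Δ)) :
    ∃ y ∈ OmegaHat p (twist σ h) (interior Δ),
      cartier σ h (AdicCompletion.of _ _ ((k.factorial : R) • frac h a (k + 1))) =
        AdicCompletion.of _ _ ((K : R) • (m.factorial : R) •
          frac _ (decimate p _ n (a * h ^ (p * (m + 1) - (k + 1)))) (m + 1)) + (p : R) • y := by
  have hsupp := fun r => SuppIn.decimate_mul_pow hΔ h0 hh hGs
    (Nat.le_add_left 1 k) hk ha r
  choose c hc using hfac
  set w : ℕ → Frac (twist σ h) := fun r =>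
    frac _ (decimate p _ n (a * h ^ (p * (m + 1) - (k + 1)) * G ^ r)) (m + 1 + r) with hw
  set e : ℕ → Frac (twist σ h) := fun r =>
    ((K : R) * c r) • ((m + r).factorial : R) • w r with he
  have hemem : ∀ r, e r ∈ Omega (twist σ h) (interior Δ) := by
    intro r
    have h1 := hsupp r
    rw [show m + 1 + r = m + r + 1 by ring] at h1
    have h2 := frac_mem_omega (h := twist σ h) h1
    rw [show m + r + 1 = m + 1 + r by ring] at h2
    exact Submodule.smul_mem _ _ h2
  -- From (m+r)! = C(m+r,m) r! m! and p^r = p^⌈r/2⌉ c_r r!, the coefficient k! C(m+r,m) p^r becomes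
  -- p^⌈r/2⌉ K c_r (m+r)!, which contains the factorial demanded by pole order m+1+r.
  have hterm : ∀ r, (k.factorial : R) • (((m + r).choose m * p ^ r : ℕ) : R) • w r =
      (p : R) ^ ((r + 1) / 2) • e r := by
    intro r
    simp only [he, smul_smul]
    congr 1
    have h1 : ((m + r).factorial : R) =
        ((m + r).choose m : R) * r.factorial * m.factorial := by
      rw [add_comm m r, ← Nat.add_choose_mul_factorial_mul_factorial r m]
      push_cast
      ring
    rw [h1, hK]
    push_cast
    rw [hc r]
    ring
  -- The terms r = 2j+1 and r = 2j+2 share the factor p^{j+1}; taking out one p leaves a series in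
  -- p^j.
  obtain ⟨y, hy, hys⟩ := exists_omegaHat_sum (p := p) (fun j => e (2 * j + 1) + e (2 * j + 2))
    (fun j => add_mem (hemem _) (hemem _))
  refine ⟨y, hy, ?_⟩
  have hzero : (K : R) • (m.factorial : R) •
      frac _ (decimate p _ n (a * h ^ (p * (m + 1) - (k + 1)))) (m + 1) =
      (k.factorial : R) • (((m + 0).choose m * p ^ 0 : ℕ) : R) • w 0 := by
    simp only [hw, pow_zero, mul_one, add_zero, Nat.choose_self, Nat.cast_one, one_smul]
    rw [hK, smul_smul]
    push_cast
    rfl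
  rw [hzero]
  refine AdicCompletion.ext fun s => ?_
  have hsum : ∀ s : ℕ, (k.factorial : R) • ∑ r ∈ Finset.range (2 * s + 1),
      (((m + r).choose m * p ^ r : ℕ) : R) • w r =
      (k.factorial : R) • (((m + 0).choose m * p ^ 0 : ℕ) : R) • w 0 +
        (p : R) • ∑ j ∈ Finset.range s, (p : R) ^ j •
          (e (2 * j + 1) + e (2 * j + 2)) := by
    intro s
    induction s with
    | zero => simp
    | succ s ih =>
      rw [show 2 * (s + 1) + 1 = 2 * s + 1 + 1 + 1 by ring, Finset.sum_range_succ,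
        Finset.sum_range_succ, Finset.sum_range_succ _ s, smul_add, smul_add, ih, hterm (2 * s + 1), hterm (2 * s + 1 + 1),
        show (2 * s + 1 + 1) / 2 = s + 1 by omega, show (2 * s + 1 + 1 + 1) / 2 = s + 1 by omega,
        pow_succ' (p : R) s, mul_smul (p : R) (p ^ s) (e (2 * s + 1)),
        mul_smul (p : R) (p ^ s) (e (2 * s + 1 + 1))]
      simp only [smul_add]
      abel
  rw [cartier_of_val, map_smul, cartierLevel_frac σ h a G hG hk s,
    AdicCompletion.val_add_apply, AdicCompletion.val_smul_apply, hys]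
  -- The terms with r ≥ s vanish modulo p^s, so the sum may be prolonged to 2s+1 terms, where the
  -- pairing comes out even.
  have hext : ∀ N, s ≤ N → (Submodule.Quotient.mk (∑ r ∈ Finset.range s,
      (((m + r).choose m * p ^ r : ℕ) : R) • w r) :
        ModPow p (R) (Frac (twist σ h)) s) =
      Submodule.Quotient.mk (∑ r ∈ Finset.range N,
        (((m + r).choose m * p ^ r : ℕ) : R) • w r) := by
    intro N hN
    induction N, hN using Nat.le_induction with
    | base => rfl
    | succ N hN ih =>
      rw [ih, Finset.sum_range_succ, eq_comm, mk_eq_mk_iff_exists, add_sub_cancel_left]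
      refine ⟨((m + N).choose m * p ^ (N - s) : ℕ) • w N, ?_⟩
      rw [← Nat.cast_smul_eq_nsmul (R), smul_smul]
      congr 1
      push_cast
      rw [mul_left_comm, ← pow_add, Nat.add_sub_cancel' hN]
  have h1 := hext (2 * s + 1) (by omega)
  rw [h1, ← Submodule.Quotient.mk_smul, hsum]
  rfl

end CartierOmega

/-! ### Successive approximation by multiples of 1/h. -/

section UnitRoot

variable {p : ℕ} {R : Type*} [CommRing R] {n : ℕ}

/-- A class of Laurent polynomials with invertible Hasse–Witt matrix of size one, over a base ring in
which the divided powers of `p` tend to zero. -/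
structure UnitRootClass (σ : FrobeniusLift p R) (Δ : Set (Fin n → ℝ)) (S : Laurent R n → Prop) :
    Prop where
  convex : Convex ℝ Δ
  mem_interior_iff : ∀ u : Fin n → ℤ, toReal u ∈ interior Δ ↔ u = 0
  exists_pow_eq : ∀ r : ℕ, ∃ c : R, (p : R) ^ r = p ^ ((r + 1) / 2) * c * (r.factorial : R)
  isUnit_add : ∀ v z : R, IsUnit v → IsUnit (v + p * z)
  twist_mem : ∀ h, S h → S (twist σ h)
  suppIn : ∀ h, S h → SuppIn h Δ
  exists_frobenius_sub : ∀ h, S h → ∃ G, inflate p _ n (twist σ h) = h ^ p + p * G ∧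
    SuppIn G ((p : ℝ) • Δ)
  isUnit_hasseWitt : ∀ h, S h → IsUnit ((h ^ (p - 1)).coeff 0)

namespace UnitRootClass

variable {σ : FrobeniusLift p R} {Δ : Set (Fin n → ℝ)} {S : Laurent R n → Prop}

theorem zero_mem (D : UnitRootClass σ Δ S) : (0 : Fin n → ℝ) ∈ Δ := by
  apply interior_subset
  rw [← toReal_zero, D.mem_interior_iff]

theorem omega_mem (D : UnitRootClass σ Δ S) (h : Laurent R n) :
    omega p h 0 ∈ OmegaHat p h (interior Δ) := by
  apply of_mem_omegaHat
  have h1 : SuppIn (AddMonoidAlgebra.single 0 1 : Laurent R n) (((0 + 1 : ℕ) : ℝ) • interior Δ) :=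
    suppIn_single_zero D.mem_interior_iff
  have h2 := frac_mem_omega (h := h) h1
  rwa [Nat.factorial_zero, Nat.cast_one, one_smul] at h2

theorem of_frac_one (D : UnitRootClass σ Δ S) (h a : Laurent R n)
    (ha : SuppIn a (((0 + 1 : ℕ) : ℝ) • interior Δ)) :
    AdicCompletion.of _ _ (frac h a (0 + 1)) = a.coeff 0 • omega p h 0 := by
  have h1 : frac h a (0 + 1) = _ := frac_eq_smul_oneDiv D.mem_interior_iff h a ha
  rw [h1, map_smul]
  rfl

variable [Fact p.Prime]

theorem suppIn_decimate (D : UnitRootClass σ Δ S) {h : Laurent R n} (hh : S h) {k m : ℕ}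
    (hk : k + 1 ≤ p * (m + 1)) {a : Laurent R n} (ha : SuppIn a (((k + 1 : ℕ) : ℝ) • interior Δ)) :
    SuppIn (decimate p R n (a * h ^ (p * (m + 1) - (k + 1)))) (((m + 1 : ℕ) : ℝ) • interior Δ) := by
  obtain ⟨G, -, hG⟩ := D.exists_frobenius_sub h hh
  have := SuppIn.decimate_mul_pow D.convex D.zero_mem (D.suppIn h hh) hG (Nat.le_add_left 1 k) hk ha 0
  rwa [pow_zero, mul_one, add_zero] at this

/-- The r = 0 term is the constant term of h^{p-1} over h^σ, so c is the Hasse–Witt entry. -/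
theorem cartier_omega (D : UnitRootClass σ Δ S) {h : Laurent R n} (hh : S h) :
    ∃ c : R, IsUnit c ∧ ∃ x ∈ OmegaHat p (twist σ h) (interior Δ),
      cartier σ h (omega p h 0) = c • omega p (twist σ h) 0 + (p : R) • x := by
  obtain ⟨G, hG, hGs⟩ := D.exists_frobenius_sub h hh
  have h1 : SuppIn (AddMonoidAlgebra.single 0 1 : Laurent R n) (((0 + 1 : ℕ) : ℝ) • interior Δ) :=
    suppIn_single_zero D.mem_interior_iff
  have hk : 0 + 1 ≤ p * (0 + 1) := by simpa using (Fact.out : p.Prime).one_le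
  obtain ⟨y, hy, e⟩ := cartier_generator σ D.exists_pow_eq D.convex D.zero_mem (D.suppIn h hh)
    hG hGs (K := 1) hk rfl h1
  refine ⟨_, D.isUnit_hasseWitt h hh, y, hy, ?_⟩
  rw [Nat.factorial_zero, Nat.cast_one, one_smul, one_smul, one_smul,
    D.of_frac_one _ _ (D.suppIn_decimate hh hk h1), decimate_coeff, smul_zero,
    ← AddMonoidAlgebra.one_def, one_mul, zero_add, mul_one] at e
  exact e

/-- For a generator of pole order k+1 take m = ⌊k/p⌋. If m = 0, the leading term has a simple pole
and is a multiple of 1/h^σ; otherwise p·m! divides k! and the leading term is itself divisible by p.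
-/
theorem cartier_of (D : UnitRootClass σ Δ S) {h : Laurent R n} (hh : S h) {ω : Frac h}
    (hω : ω ∈ Omega h (interior Δ)) :
    ∃ c : R, ∃ x ∈ OmegaHat p (twist σ h) (interior Δ),
      cartier σ h (AdicCompletion.of _ _ ω) = c • omega p (twist σ h) 0 + (p : R) • x := by
  obtain ⟨G, hG, hGs⟩ := D.exists_frobenius_sub h hh
  induction hω using Submodule.span_induction with
  | zero => exact ⟨0, 0, Submodule.zero_mem _, by simp⟩
  | add x y _ _ hx hy =>
    obtain ⟨c, x', hx', hx⟩ := hx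
    obtain ⟨d, y', hy', hy⟩ := hy
    refine ⟨c + d, x' + y', add_mem hx' hy', ?_⟩
    rw [map_add, map_add, hx, hy, add_smul, smul_add]
    abel
  | smul r x _ hx =>
    obtain ⟨c, x', hx', hx⟩ := hx
    refine ⟨r * c, r • x', Submodule.smul_mem _ _ hx', ?_⟩
    rw [map_smul, map_smul, hx, smul_add, mul_smul, smul_comm r (p : R)]
  | mem x hx =>
    obtain ⟨k', a, hk', ha, rfl⟩ := hx
    obtain ⟨k, rfl⟩ := Nat.exists_eq_succ_of_ne_zero (by omega : k' ≠ 0)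
    rw [Nat.succ_eq_add_one, Nat.add_sub_cancel, ← Nat.cast_smul_eq_nsmul R]
    have hp := (Fact.out : p.Prime).pos
    have hk : k + 1 ≤ p * (k / p + 1) := by
      have h1 := Nat.div_add_mod k p
      have h2 := Nat.mod_lt k hp
      rw [mul_add, mul_one]
      omega
    by_cases hm : k / p = 0
    · rw [hm] at hk
      obtain ⟨y, hy, e⟩ := cartier_generator σ D.exists_pow_eq D.convex D.zero_mem (D.suppIn h hh)
        hG hGs (K := k.factorial) hk (by simp) ha
      rw [Nat.factorial_zero, Nat.cast_one, one_smul, (AdicCompletion.of _ (Frac (twist σ h))).map_smul,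
        D.of_frac_one _ _ (D.suppIn_decimate hh hk ha), smul_smul] at e
      exact ⟨_, y, hy, e⟩
    · obtain ⟨K, hK⟩ := mul_factorial_dvd (p := p) (Nat.one_le_iff_ne_zero.2 hm) (Nat.mul_div_le k p)
      obtain ⟨y, hy, e⟩ := cartier_generator σ D.exists_pow_eq D.convex D.zero_mem (D.suppIn h hh)
        hG hGs (K := p * K) hk (by rw [hK]; ring) ha
      refine ⟨0, _, add_mem (Submodule.smul_mem _ (K : R) (of_mem_omegaHat
        (frac_mem_omega (D.suppIn_decimate hh hk ha)))) hy, ?_⟩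
      rw [e, zero_smul, zero_add, smul_add, Nat.cast_mul, mul_smul, map_smul, map_smul]

theorem cartier_mem (D : UnitRootClass σ Δ S) {h : Laurent R n} (hh : S h)
    {y : Compl p R (Frac h)} (hy : y ∈ OmegaHat p h (interior Δ)) :
    cartier σ h y ∈ OmegaHat p (twist σ h) (interior Δ) := by
  -- The summand z absorbs 𝒞_p ω, which is only in the completed module; this makes the set stable
  -- under splitting off a term of Ω and dividing the rest by p.
  refine subset_omegaHat (S := {w | ∃ y ∈ OmegaHat p h (interior Δ),
    ∃ z ∈ OmegaHat p (twist σ h) (interior Δ), w = cartier σ h y + z}) ?_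
    ⟨y, hy, 0, Submodule.zero_mem _, (add_zero _).symm⟩
  rintro _ ⟨y, hy, z, hz, rfl⟩
  obtain ⟨ω, hω, y', hy', rfl⟩ := exists_of_add_of_mem_omegaHat hy
  obtain ⟨c, x, hx, e⟩ := D.cartier_of hh hω
  obtain ⟨ω', hω', z', hz', e'⟩ := exists_of_add_of_mem_omegaHat
    (add_mem (add_mem (Submodule.smul_mem _ c (D.omega_mem (twist σ h)))
      (Submodule.smul_mem _ (p : R) hx)) hz)
  refine ⟨ω', hω', _, ⟨y', hy', z', hz', rfl⟩, ?_⟩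
  rw [map_add, map_smul, e, smul_add, add_right_comm, e']
  abel

theorem cartier_eq (D : UnitRootClass σ Δ S) {h : Laurent R n} (hh : S h)
    {y : Compl p R (Frac h)} (hy : y ∈ OmegaHat p h (interior Δ)) :
    ∃ c : R, ∃ x ∈ OmegaHat p (twist σ h) (interior Δ),
      cartier σ h y = c • omega p (twist σ h) 0 + (p : R) • x := by
  obtain ⟨ω, hω, y', hy', rfl⟩ := exists_of_add_of_mem_omegaHat hy
  obtain ⟨c, x, hx, e⟩ := D.cartier_of hh hω
  refine ⟨c, _, add_mem hx (D.cartier_mem hh hy'), ?_⟩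
  rw [map_add, map_smul, e, smul_add, add_assoc]

theorem cartierIter_mem (D : UnitRootClass σ Δ S) (s : ℕ) {h : Laurent R n} (hh : S h)
    {y : Compl p R (Frac h)} (hy : y ∈ OmegaHat p h (interior Δ)) :
    cartierIter σ s h y ∈ OmegaHat p ((twist σ)^[s] h) (interior Δ) := by
  induction s generalizing h with
  | zero => exact hy
  | succ s ih => exact ih (D.twist_mem h hh) (D.cartier_mem hh hy)

end UnitRootClass

variable [Fact p.Prime]

/-- The elements whose first `s` images under the Cartier operator have the divisibility required of
the elements of `U`. -/
def cartierKer (σ : FrobeniusLift p R) (μ : Set (Fin n → ℝ)) :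
    ℕ → (h : Laurent R n) → Submodule R (Compl p R (Frac h))
  | 0, h => OmegaHat p h μ
  | s + 1, h => OmegaHat p h μ ⊓ ((p : R) • cartierKer σ μ s (twist σ h)).comap (cartier σ h)

theorem mem_cartierKer_succ {σ : FrobeniusLift p R} {μ : Set (Fin n → ℝ)} {s : ℕ}
    {h : Laurent R n} {y : Compl p R (Frac h)} :
    y ∈ cartierKer σ μ (s + 1) h ↔ y ∈ OmegaHat p h μ ∧
      ∃ x ∈ cartierKer σ μ s (twist σ h), cartier σ h y = (p : R) • x := by
  rw [cartierKer, Submodule.mem_inf, Submodule.mem_comap, Submodule.mem_smul_pointwise_iff_exists]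
  simp only [eq_comm]

theorem cartierKer_succ_le {σ : FrobeniusLift p R} {μ : Set (Fin n → ℝ)} (s : ℕ)
    (h : Laurent R n) : cartierKer σ μ (s + 1) h ≤ cartierKer σ μ s h := by
  intro y hy
  induction s generalizing h with
  | zero => exact (mem_cartierKer_succ.1 hy).1
  | succ s ih =>
    obtain ⟨h1, x, hx, e⟩ := mem_cartierKer_succ.1 hy
    exact mem_cartierKer_succ.2 ⟨h1, x, ih _ hx, e⟩

/-- The recursive condition divides by p after each application of 𝒞_p, so it implies the condition
in `U` without cancelling p in the completion. -/
theorem cartierIter_mem_of_mem_cartierKer {σ : FrobeniusLift p R} {μ : Set (Fin n → ℝ)} (s : ℕ)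
    {h : Laurent R n} {y : Compl p R (Frac h)} (hy : y ∈ cartierKer σ μ s h) :
    cartierIter σ s h y ∈ (p : R) ^ s • OmegaHat p ((twist σ)^[s] h) μ := by
  induction s generalizing h with
  | zero => rw [pow_zero, one_smul]; exact hy
  | succ s ih =>
    obtain ⟨-, x, hx, e⟩ := mem_cartierKer_succ.1 hy
    obtain ⟨z, hz, hz'⟩ := (Submodule.mem_smul_pointwise_iff_exists _ _ _).1 (ih hx)
    refine (Submodule.mem_smul_pointwise_iff_exists _ _ _).2 ⟨z, hz, ?_⟩
    have h1 : cartierIter σ s (twist σ h) (cartier σ h y) =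
        (p : R) • cartierIter σ s (twist σ h) x := by
      rw [e]
      exact LinearMap.map_smul _ _ _
    refine Eq.trans ?_ h1.symm
    rw [← hz', smul_smul, ← pow_succ']
    rfl

theorem mem_U_iff {σ : FrobeniusLift p R} {μ : Set (Fin n → ℝ)} {h : Laurent R n}
    {y : Compl p R (Frac h)} : y ∈ U σ h μ ↔ y ∈ OmegaHat p h μ ∧ ∀ s, 1 ≤ s →
      cartierIter σ s h y ∈ (p : R) ^ s • OmegaHat p ((twist σ)^[s] h) μ := by
  simp [U, Submodule.mem_iInf]

/-- Write ω = 1/h, ω' = 1/h^σ, 𝒞_p ω = bω' + px and 𝒞_p y = cω' + px'. Reducing x and x' by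
induction to multiples lω' and l'ω' leaves (b + pl)ω' and (c + pl')ω'; as b + pl is a unit,
subtracting (c + pl')/(b + pl) times ω from y cancels the ω' part. -/
theorem UnitRootClass.exists_sub_mem_cartierKer {σ : FrobeniusLift p R} {Δ : Set (Fin n → ℝ)}
    {S : Laurent R n → Prop} (D : UnitRootClass σ Δ S) (s : ℕ) {h : Laurent R n} (hh : S h)
    {y : Compl p R (Frac h)} (hy : y ∈ OmegaHat p h (interior Δ)) :
    ∃ l : R, y - l • omega p h 0 ∈ cartierKer σ (interior Δ) s h := by
  induction s generalizing h with
  | zero => exact ⟨0, by rw [zero_smul, sub_zero]; exact hy⟩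
  | succ s ih =>
    have hh' := D.twist_mem h hh
    obtain ⟨b, hb, x, hx, e⟩ := D.cartier_omega hh
    obtain ⟨c, x', hx', e'⟩ := D.cartier_eq hh hy
    obtain ⟨l, hl⟩ := ih hh' hx
    obtain ⟨l', hl'⟩ := ih hh' hx'
    obtain ⟨v, hv⟩ := (D.isUnit_add b l hb).exists_right_inv
    refine ⟨(c + p * l') * v, mem_cartierKer_succ.2
      ⟨sub_mem hy (Submodule.smul_mem _ _ (D.omega_mem h)), _,
        sub_mem hl' (Submodule.smul_mem _ ((c + p * l') * v) hl), ?_⟩⟩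
    rw [map_sub, map_smul, e, e']
    have h1 : (c + p * l') * v * b = c + p * l' - (c + p * l') * v * (p * l) := by
      linear_combination (c + p * l') * hv
    simp only [smul_sub, smul_add, smul_smul, h1]
    simp only [sub_smul, add_smul]
    rw [mul_comm _ (p : R), show (c + p * l') * v * (p * l) = p * ((c + p * l') * v * l) by ring]
    simp only [mul_assoc, mul_left_comm (p : R)]
    abel

end UnitRoot

/-! ### Bases with one element. -/

section RankOne

variable {R M N : Type*} [CommRing R] [AddCommGroup M] [Module R M] [AddCommGroup N] [Module R N]

theorem exists_basis_fin_one (x : M) (hinj : ∀ r : R, r • x = 0 → r = 0)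
    (hsurj : ∀ y : M, ∃ r : R, r • x = y) : ∃ b : Module.Basis (Fin 1) R M, b 0 = x := by
  let e : R ≃ₗ[R] M := LinearEquiv.ofBijective (LinearMap.toSpanSingleton R M x)
    ⟨(injective_iff_map_eq_zero _).2 hinj, hsurj⟩
  refine ⟨(Module.Basis.singleton (Fin 1) R).map e, ?_⟩
  rw [Module.Basis.map_apply, Module.Basis.singleton_apply]
  exact one_smul R x

theorem toMatrix_fin_one (b : Module.Basis (Fin 1) R M) (b' : Module.Basis (Fin 1) R N)
    (T : M →ₗ[R] N) (l : R) (h : T (b 0) = l • b' 0) : LinearMap.toMatrix b b' T = !![l] := by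
  ext i j
  rw [Subsingleton.elim i 0, Subsingleton.elim j 0, LinearMap.toMatrix_apply, h]
  simp

end RankOne

/-! ### Constant terms detect U; the rank one quotient and its matrix. -/

section Kernel

variable {p : ℕ} {R A : Type*} [CommRing R] [CommRing A] [Algebra R (PowerSeries A)] {n : ℕ}

theorem constHat_smul_omega {h : Laurent R n} (hu : IsUnit (expandT A n h)) (l : R) :
    constHat p h hu (l • omega p h 0) = AdicCompletion.of _ _ (l • constFrac h hu (oneDiv h)) := by
  rw [map_smul, map_smul]
  exact congrArg (l • ·) (constHat_of h hu (oneDiv h))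

variable [Fact p.Prime] {σ : FrobeniusLift p R} {S : Laurent R n → Prop}

theorem constHat_cartierIter (hS : ∀ h, S h → S (twist σ h))
    (hu : ∀ h, S h → IsUnit (expandT A n h)) (s : ℕ) {h : Laurent R n} (hh : S h)
    (y : Compl p R (Frac h)) :
    ∃ hu' : IsUnit (expandT A n ((twist σ)^[s] h)),
      constHat p _ hu' (cartierIter σ s h y) = constHat p h (hu h hh) y := by
  induction s generalizing h with
  | zero => exact ⟨hu h hh, rfl⟩
  | succ s ih =>
    obtain ⟨hu', e⟩ := ih (hS h hh) (cartier σ h y)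
    exact ⟨hu', e.trans (constHat_cartier σ (hu h hh) (hu _ (hS h hh)) y)⟩

theorem exists_constHat_eq_smul (hS : ∀ h, S h → S (twist σ h))
    (hu : ∀ h, S h → IsUnit (expandT A n h)) (s : ℕ) {h : Laurent R n} (hh : S h)
    {μ : Set (Fin n → ℝ)} {y : Compl p R (Frac h)}
    (hy : cartierIter σ s h y ∈ (p : R) ^ s • OmegaHat p ((twist σ)^[s] h) μ) :
    ∃ z, constHat p h (hu h hh) y = (p : R) ^ s • z := by
  obtain ⟨hu', e⟩ := constHat_cartierIter hS hu s hh y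
  obtain ⟨w, -, hw⟩ := (Submodule.mem_smul_pointwise_iff_exists _ _ _).1 hy
  refine ⟨constHat p _ hu' w, ?_⟩
  rw [← e, ← hw]
  exact LinearMap.map_smul _ _ _

/-- The constant term of l/h equals that of its image under 𝒞_p^s, hence is divisible by p^s; the
constant term of 1/h being a unit, so is l. This yields uniqueness of coefficients and convergence
of approximations. -/
theorem pow_dvd_of_smul_omega (hS : ∀ h, S h → S (twist σ h))
    (hu : ∀ h, S h → IsUnit (expandT A n h)) (s : ℕ) {h : Laurent R n} (hh : S h)
    (h1 : IsUnit (constFrac h (hu h hh) (oneDiv h))) {μ : Set (Fin n → ℝ)} {l : R}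
    (hl : cartierIter σ s h (l • omega p h 0) ∈ (p : R) ^ s • OmegaHat p ((twist σ)^[s] h) μ) :
    (p : PowerSeries A) ^ s ∣ algebraMap R (PowerSeries A) l := by
  obtain ⟨z, hz⟩ := exists_constHat_eq_smul hS hu s hh hl
  rw [constHat_smul_omega] at hz
  have h2 := dvd_of_of_eq (x := l • constFrac h (hu h hh) (oneDiv h)) (y := 0) s (z := z)
    (by rw [map_zero, sub_zero]; exact hz)
  rwa [sub_zero, Algebra.smul_def, h1.dvd_mul_right] at h2

theorem pow_dvd_of_sub_mem_U (hS : ∀ h, S h → S (twist σ h))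
    (hu : ∀ h, S h → IsUnit (expandT A n h)) {h : Laurent R n} (hh : S h)
    {μ : Set (Fin n → ℝ)} {l : R}
    (hl : cartier σ h (omega p h 0) - l • omega p (twist σ h) 0 ∈ U σ (twist σ h) μ) (s : ℕ) :
    (p : PowerSeries A) ^ s ∣ constFrac h (hu h hh) (oneDiv h) -
      l • constFrac _ (hu _ (hS h hh)) (oneDiv (twist σ h)) := by
  obtain _ | s := s
  · simp
  obtain ⟨z, hz⟩ := exists_constHat_eq_smul hS hu (s + 1) (hS h hh)
    ((mem_U_iff.1 hl).2 (s + 1) (Nat.le_add_left 1 s))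
  rw [map_sub, constHat_cartier σ (hu h hh), constHat_smul_omega] at hz
  have h2 := constHat_of (p := p) h (hu h hh) (oneDiv h)
  change constHat p h (hu h hh) (omega p h 0) = _ at h2
  rw [h2] at hz
  exact dvd_of_of_eq (s + 1) hz

theorem UnitRootClass.exists_sub_mem_U {Δ : Set (Fin n → ℝ)} (D : UnitRootClass σ Δ S)
    (hdvd : ∀ (s : ℕ) (l : R), (p : PowerSeries A) ^ s ∣ algebraMap R (PowerSeries A) l →
      (p : R) ^ s ∣ l)
    (hlim : ∀ l : ℕ → R, (∀ s, (p : R) ^ s ∣ l (s + 1) - l s) → ∃ L, ∀ s, (p : R) ^ s ∣ L - l s)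
    (hu : ∀ h, S h → IsUnit (expandT A n h)) {h : Laurent R n} (hh : S h)
    (h1 : IsUnit (constFrac h (hu h hh) (oneDiv h)))
    {y : Compl p R (Frac h)} (hy : y ∈ OmegaHat p h (interior Δ)) :
    ∃ l : R, y - l • omega p h 0 ∈ U σ h (interior Δ) := by
  choose l hl using fun s => D.exists_sub_mem_cartierKer s hh hy
  -- Two successive approximations differ by a multiple of 1/h lying in the s-th kernel, so they
  -- agree modulo p^s.
  obtain ⟨L, hL⟩ := hlim l fun s => by
    apply hdvd
    apply pow_dvd_of_smul_omega D.twist_mem hu s hh h1 (μ := interior Δ)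
    apply cartierIter_mem_of_mem_cartierKer
    have := sub_mem (hl s) (cartierKer_succ_le s h (hl (s + 1)))
    rwa [sub_sub_sub_cancel_left, ← sub_smul] at this
  refine ⟨L, mem_U_iff.2 ⟨sub_mem hy (Submodule.smul_mem _ _ (D.omega_mem h)), fun s _ => ?_⟩⟩
  obtain ⟨d, hd⟩ := hL s
  obtain ⟨z, hz, hz'⟩ := (Submodule.mem_smul_pointwise_iff_exists _ _ _).1
    (cartierIter_mem_of_mem_cartierKer s (hl s))
  refine (Submodule.mem_smul_pointwise_iff_exists _ _ _).2
    ⟨z - d • cartierIter σ s h (omega p h 0), sub_mem hz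
      (Submodule.smul_mem _ _ (D.cartierIter_mem s hh (D.omega_mem h))), ?_⟩
  -- Replacing l_s by L costs p^s d/h, whose image under 𝒞_p^s is p^s times an element of the
  -- completed Ω.
  have e : y - L • omega p h 0 = (y - l s • omega p h 0) - ((p : R) ^ s * d) • omega p h 0 := by
    rw [← hd, sub_smul]
    abel
  rw [e, (cartierIter σ s h).map_sub, ← hz', (cartierIter σ s h).map_smul, smul_sub, smul_smul]

theorem UnitRootClass.exists_basis {Δ : Set (Fin n → ℝ)} (D : UnitRootClass σ Δ S)
    (hdvd : ∀ (s : ℕ) (l : R), (p : PowerSeries A) ^ s ∣ algebraMap R (PowerSeries A) l →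
      (p : R) ^ s ∣ l)
    (hlim : ∀ l : ℕ → R, (∀ s, (p : R) ^ s ∣ l (s + 1) - l s) → ∃ L, ∀ s, (p : R) ^ s ∣ L - l s)
    (hsep : ∀ l : R, (∀ s, (p : R) ^ s ∣ l) → l = 0)
    (hu : ∀ h, S h → IsUnit (expandT A n h)) {h : Laurent R n} (hh : S h)
    (h1 : IsUnit (constFrac h (hu h hh) (oneDiv h))) :
    ∃ b : Module.Basis (Fin 1) R (Q σ h (interior Δ)),
      b 0 = Submodule.Quotient.mk ⟨omega p h 0, D.omega_mem h⟩ := by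
  apply exists_basis_fin_one
  · intro l hl
    rw [← Submodule.Quotient.mk_smul, Submodule.Quotient.mk_eq_zero] at hl
    have hl' : l • omega p h 0 ∈ U σ h (interior Δ) := hl
    refine hsep l fun s => hdvd s l ?_
    obtain _ | s := s
    · simp
    · exact pow_dvd_of_smul_omega D.twist_mem hu (s + 1) hh h1
        ((mem_U_iff.1 hl').2 (s + 1) (Nat.le_add_left 1 s))
  · intro y
    obtain ⟨⟨y, hy⟩, rfl⟩ := Submodule.Quotient.mk_surjective _ y
    obtain ⟨l, hl⟩ := D.exists_sub_mem_U hdvd hlim hu hh h1 hy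
    refine ⟨l, ?_⟩
    rw [← Submodule.Quotient.mk_smul, eq_comm, Submodule.Quotient.eq]
    exact hl

theorem UnitRootClass.cartier_mem_U {Δ : Set (Fin n → ℝ)} (D : UnitRootClass σ Δ S)
    {h : Laurent R n} (hh : S h) {y : Compl p R (Frac h)} (hy : y ∈ U σ h (interior Δ)) :
    cartier σ h y ∈ U σ (twist σ h) (interior Δ) := by
  obtain ⟨h1, h2⟩ := mem_U_iff.1 hy
  refine mem_U_iff.2 ⟨D.cartier_mem hh h1, fun s _ => ?_⟩
  obtain ⟨z, hz, e⟩ := (Submodule.mem_smul_pointwise_iff_exists _ _ _).1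
    (h2 (s + 1) (Nat.le_add_left 1 s))
  refine (Submodule.mem_smul_pointwise_iff_exists _ _ _).2
    ⟨(p : R) • z, Submodule.smul_mem _ _ hz, ?_⟩
  have e' : (p : R) ^ s • (p : R) • z = (p : R) ^ (s + 1) • z := by rw [smul_smul, ← pow_succ]
  exact e'.trans e

/-- The rank one unit-root crystal attached to a class of Laurent polynomials. -/
theorem UnitRootClass.exists_matrix {Δ : Set (Fin n → ℝ)} (D : UnitRootClass σ Δ S)
    (hdvd : ∀ (s : ℕ) (l : R), (p : PowerSeries A) ^ s ∣ algebraMap R (PowerSeries A) l →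
      (p : R) ^ s ∣ l)
    (hlim : ∀ l : ℕ → R, (∀ s, (p : R) ^ s ∣ l (s + 1) - l s) → ∃ L, ∀ s, (p : R) ^ s ∣ L - l s)
    (hsep : ∀ l : R, (∀ s, (p : R) ^ s ∣ l) → l = 0)
    (hu : ∀ h, S h → IsUnit (expandT A n h)) {h : Laurent R n} (hh : S h)
    (h1 : IsUnit (constFrac h (hu h hh) (oneDiv h)))
    (h2 : IsUnit (constFrac _ (hu _ (D.twist_mem h hh)) (oneDiv (twist σ h)))) {L : R}
    (hL : L • constFrac _ (hu _ (D.twist_mem h hh)) (oneDiv (twist σ h)) =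
      constFrac h (hu h hh) (oneDiv h)) :
    ∃ (hΩ : ∀ ω ∈ OmegaHat p h (interior Δ), cartier σ h ω ∈ OmegaHat p (twist σ h) (interior Δ))
      (hU : ∀ ω ∈ U σ h (interior Δ), cartier σ h ω ∈ U σ (twist σ h) (interior Δ))
      (h₁ : omega p h 0 ∈ OmegaHat p h (interior Δ))
      (h₂ : omega p (twist σ h) 0 ∈ OmegaHat p (twist σ h) (interior Δ))
      (b : Module.Basis (Fin 1) R (Q σ h (interior Δ)))
      (b' : Module.Basis (Fin 1) R (Q σ (twist σ h) (interior Δ))),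
      b 0 = Submodule.Quotient.mk ⟨omega p h 0, h₁⟩ ∧
      b' 0 = Submodule.Quotient.mk ⟨omega p (twist σ h) 0, h₂⟩ ∧
      LinearMap.toMatrix b b' (cartierQ σ h (interior Δ) hΩ hU) = !![L] := by
  have hh' := D.twist_mem h hh
  obtain ⟨b, hb⟩ := D.exists_basis hdvd hlim hsep hu hh h1
  obtain ⟨b', hb'⟩ := D.exists_basis hdvd hlim hsep hu hh' h2
  refine ⟨fun ω hω => D.cartier_mem hh hω, fun ω hω => D.cartier_mem_U hh hω, D.omega_mem h,
    D.omega_mem _, b, b', hb, hb', toMatrix_fin_one _ _ _ _ ?_⟩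
  obtain ⟨l, hl⟩ := D.exists_sub_mem_U hdvd hlim hu hh' h2 (D.cartier_mem hh (D.omega_mem h))
  -- The constant term of 𝒞_p(1/h) - l/h^σ is divisible by every p^s; it equals (L - l) times that
  -- of 1/h^σ, a unit.
  have hlL : l = L := by
    refine (sub_eq_zero.1 (hsep _ fun s => hdvd s _ ?_)).symm
    have h3 := pow_dvd_of_sub_mem_U D.twist_mem hu hh hl s
    rw [← hL, ← sub_smul, Algebra.smul_def, h2.dvd_mul_right] at h3
    exact h3
  rw [hb, hb', ← hlL, ← Submodule.Quotient.mk_smul]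
  exact (Submodule.Quotient.eq _).2 hl

end Kernel

/-! ### Completeness of the base ring. -/

section Limits

open Polynomial

variable {p : ℕ} [Fact p.Prime] {β : ℤ_[p][X]}

/-- Limits are taken coefficient by coefficient in the complete ring ℤ_p. -/
theorem powerSeries_exists_limit (l : ℕ → PowerSeries ℤ_[p])
    (hl : ∀ s, (p : PowerSeries ℤ_[p]) ^ s ∣ l (s + 1) - l s) :
    ∃ L, ∀ s, (p : PowerSeries ℤ_[p]) ^ s ∣ L - l s := by
  choose d hd using hl
  have hcoeff : ∀ (s k : ℕ) (e : PowerSeries ℤ_[p]),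
      PowerSeries.coeff k ((p : PowerSeries ℤ_[p]) ^ s * e) = p ^ s * PowerSeries.coeff k e := by
    intro s k e
    rw [← Nat.cast_pow, ← nsmul_eq_mul, map_nsmul, nsmul_eq_mul, Nat.cast_pow]
  have key : ∀ k, ∃ L : ℤ_[p], ∀ s, (p : ℤ_[p]) ^ s ∣ L - PowerSeries.coeff k (l s) := by
    intro k
    have h1 : ∀ s t, s ≤ t →
        (p : ℤ_[p]) ^ s ∣ PowerSeries.coeff k (l s) - PowerSeries.coeff k (l t) := by
      intro s t hst
      induction t, hst using Nat.le_induction with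
      | base => simp
      | succ t ht ih =>
        have h2 : (p : ℤ_[p]) ^ t ∣ PowerSeries.coeff k (l (t + 1)) - PowerSeries.coeff k (l t) :=
          ⟨PowerSeries.coeff k (d t), by rw [← map_sub, hd, hcoeff]⟩
        have h3 := dvd_sub ih ((pow_dvd_pow _ ht).trans h2)
        rwa [sub_sub_sub_cancel_right] at h3
    obtain ⟨L, hL⟩ := IsPrecomplete.prec (inferInstance :
      IsPrecomplete (IsLocalRing.maximalIdeal ℤ_[p]) ℤ_[p])
      (f := fun s => PowerSeries.coeff k (l s)) (fun {s t} hst => by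
        rw [SModEq.sub_mem, smul_eq_mul, Ideal.mul_top, PadicInt.maximalIdeal_eq_span_p,
          Ideal.span_singleton_pow, Ideal.mem_span_singleton]
        exact h1 s t hst)
    refine ⟨L, fun s => ?_⟩
    have h2 := (hL s).symm
    rwa [SModEq.sub_mem, smul_eq_mul, Ideal.mul_top, PadicInt.maximalIdeal_eq_span_p,
      Ideal.span_singleton_pow, Ideal.mem_span_singleton] at h2
  choose L hL using key
  choose e he using hL
  refine ⟨PowerSeries.mk L, fun s => ⟨PowerSeries.mk fun k => e k s, ?_⟩⟩
  ext k
  rw [hcoeff, map_sub, PowerSeries.coeff_mk, PowerSeries.coeff_mk, he]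

theorem completedAlg_exists_limit (hβ : β.coeff 0 = 1) (l : ℕ → completedAlg β)
    (hl : ∀ s, (p : completedAlg β) ^ s ∣ l (s + 1) - l s) :
    ∃ L, ∀ s, (p : completedAlg β) ^ s ∣ L - l s := by
  obtain ⟨L, hL⟩ := powerSeries_exists_limit (fun s => (l s : PowerSeries ℤ_[p]))
    fun s => (completedAlg_dvd_iff hβ s _).1 (hl s)
  exact ⟨⟨L, mem_of_closed fun s => ⟨l s, (l s).2, hL s⟩⟩,
    fun s => (completedAlg_dvd_iff hβ s _).2 (hL s)⟩

end Limits

/-! ### Application to the pencil 1 - t g(x). -/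

section Main

variable {p : ℕ} [Fact p.Prime] {n : ℕ} {g : Laurent ℤ_[p] n}

theorem unitRootClass_admissible (hp : p ≠ 2)
    (hg : ∀ u : Fin n → ℤ, toReal u ∈ interior (newtonPolytope g) ↔ u = 0)
    (h0 : (0 : Fin n → ℝ) ∈ newtonPolytope g) :
    UnitRootClass (sigma g) (newtonPolytope g) (Admissible g) where
  convex := convex_newtonPolytope g
  mem_interior_iff := hg
  exists_pow_eq r := by
    obtain ⟨c, hc⟩ := exists_pow_eq_mul_factorial hp r
    refine ⟨algebraMap ℤ_[p] _ c, ?_⟩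
    simpa only [map_mul, map_pow, map_natCast] using congrArg (algebraMap ℤ_[p] (BaseRing g)) hc
  isUnit_add v z hv := completedAlg_isUnit_add hv z
  twist_mem h hh := hh.twist
  suppIn h hh := hh.suppIn
  exists_frobenius_sub h hh := hh.exists_frobenius_sub h0
  isUnit_hasseWitt h hh := hh.isUnit_hasseWitt

end Main

end DworkCrystal

end

open DworkCrystal
theorem mainTheorem7 (p : ℕ) [Fact p.Prime] (n : ℕ) (g : Laurent ℤ_[p] n)
    (hg : ∀ u : Fin n → ℤ, toReal u ∈ interior (newtonPolytope g) ↔ u = 0) :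
    ∃ Λ : BaseRing g,
      IsUnit (substPow p (qSeries g)) ∧
      (Λ : PowerSeries ℤ_[p]) * substPow p (qSeries g) = qSeries g ∧
      (p ≠ 2 →
        ∃ (hΩ : ∀ ω ∈ OmegaHat p (fPoly g) (interior (newtonPolytope g)),
            cartier (sigma g) (fPoly g) ω ∈
              OmegaHat p (twist (sigma g) (fPoly g)) (interior (newtonPolytope g)))
          (hU : ∀ ω ∈ U (sigma g) (fPoly g) (interior (newtonPolytope g)),
            cartier (sigma g) (fPoly g) ω ∈
              U (sigma g) (twist (sigma g) (fPoly g)) (interior (newtonPolytope g)))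
          (h₁ : omega p (fPoly g) 0 ∈ OmegaHat p (fPoly g) (interior (newtonPolytope g)))
          (h₂ : omega p (twist (sigma g) (fPoly g)) 0 ∈
            OmegaHat p (twist (sigma g) (fPoly g)) (interior (newtonPolytope g)))
          (b : Module.Basis (Fin 1) (BaseRing g)
            (Q (sigma g) (fPoly g) (interior (newtonPolytope g))))
          (b' : Module.Basis (Fin 1) (BaseRing g)
            (Q (sigma g) (twist (sigma g) (fPoly g)) (interior (newtonPolytope g)))),
          b 0 = Submodule.Quotient.mk ⟨omega p (fPoly g) 0, h₁⟩ ∧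
          b' 0 = Submodule.Quotient.mk ⟨omega p (twist (sigma g) (fPoly g)) 0, h₂⟩ ∧
          LinearMap.toMatrix b b'
            (cartierQ (sigma g) (fPoly g) (interior (newtonPolytope g)) hΩ hU) = !![Λ]) := by
  have h0 : (0 : Fin n → ℝ) ∈ newtonPolytope g := by
    apply interior_subset
    rw [← toReal_zero, hg]
  obtain ⟨L, hL⟩ := exists_ratio hg h0
  have hq := (isUnit_qSeries g).map (substPow p)
  refine ⟨L, hq, hL, fun hp => ?_⟩
  have H := admissible_fPoly h0
  have e1 := const_oneDiv_fPoly H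
  have e2 := const_oneDiv_twist H
  rw [e1] at e2
  refine (unitRootClass_admissible hp hg h0).exists_matrix (A := ℤ_[p])
    (fun s l hl => (completedAlg_dvd_iff (beta_coeff_zero g) s l).2 hl)
    (completedAlg_exists_limit (beta_coeff_zero g)) (fun l hl => Subtype.ext
      (eq_zero_of_forall_pow_dvd fun s => (completedAlg_dvd_iff (beta_coeff_zero g) s l).1 (hl s)))
    (fun h hh => hh.isUnit) H (e1 ▸ isUnit_qSeries g) (e2 ▸ hq) ?_
  rw [Subalgebra.smul_def, smul_eq_mul]
  exact (congrArg _ e2).trans (hL.trans e1.symm)
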